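/- Let $\mathcal O=\mathbb C[[t]]$, $\mathcal K=\mathbb C((t))$. For a connected reductive complex group $G$ with maximal torus $T$, Borel subgroup $B\supseteq T$ and Weyl group $W$, and a cocharacter $\lambda$ of $T$, let $[\lambda]\in G(\mathcal K)/G(\mathcal O)$ be the class of $t^\lambda$. For $\lambda$ dominant, write $d(L_1,L_2)=\lambda$ if $(L_1,L_2)=g([0],[\lambda])$ for some $g\in G(\mathcal K)$. For dominant $\lambda,\mu,\nu$ let $$\mathrm{Gr}_{G,c(\lambda,\mu,\nu)}=\{(L_1,L_2,L_3)\in (G(\mathcal K)/G(\mathcal O))^3 : L_3=[0],\ d(L_3,L_1)=\lambda,\ d(L_1,L_2)=\mu,\ d(L_2,L_3)=\nu\}$$ be the cyclic convolution variety, with its Zariski topology and its diagonal left action of $G(\mathcal O)$. Let $\rho$ be the half-sum of the positive roots. **Theorem.** There exist $G$, dominant $\lambda,\mu,\nu$, and a top-dimensional irreducible component $A$ of $\mathrm{Gr}_{G,c(\lambda,\mu,\nu)}$, of dimension $\langle\rho,\lambda+\mu+\nu\rangle$, such that (1) $A=\overline{G(\mathcal O)x}$ for some point $x$, and (2) there are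 no $v,w\in W$ with $\nu=v(-\lambda-w\mu)$. Explicitly, take $G=SL_2$ with its diagonal torus and upper triangular Borel subgroup, and $\lambda=\mu=\nu=\alpha^\vee$, the positive coroot, so that $t^{\alpha^\vee}=\mathrm{diag}(t,t^{-1})$. Then $\alpha^\vee$ is dominant, $\langle\rho,3\alpha^\vee\rangle=3$, and (2) holds. With $y=\begin{pmatrix}1&t\\0&1\end{pmatrix}t^{\alpha^\vee}$, the point $x=([\alpha^\vee],\,y\,SL_2(\mathcal O),\,[0])$ lies in $\mathrm{Gr}_{SL_2,c(\alpha^\vee,\alpha^\vee,\alpha^\vee)}$; its orbit $SL_2(\mathcal O)x$ has dimension $3$; the closure of this orbit in the cyclic convolution variety is an irreducible component of dimension $3$; and every irreducible component has dimension at most $3$. Moreover the Lie algebra of the stabilizer of $x$ in $SL_2(\mathcal O)$ is $t^2e(\mathcal O)\oplus t\,h(\mathcal O)\oplus f(\mathcal O)$, where $e,h,f$ is the standard basis of $\mathfrak{sl}_2(\mathbb C)$, and it has codimension $3$ over $\mathbb C$ in $\mathfrak{sl}_2(\mathcal O)$. -/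

import Mathlib

open Matrix

noncomputable section

namespace CyclicConvolution

/-- The ring `ℂ[[t]]` of formal power series. -/
abbrev 𝒪 : Type := PowerSeries ℂ

/-- The field `ℂ((t))` of formal Laurent series. -/
abbrev 𝒦 : Type := LaurentSeries ℂ

/-! ### Cocharacters of the diagonal torus of `SL_n`, Weyl group, dominance -/

/-- The cocharacter lattice `X_*(T)` of the diagonal torus `T` of `SL_n`: the cocharacter
`s ↦ diag(s ^ a₁, …, s ^ aₙ)` is recorded by its exponents, whose sum is `0`. -/
def Cochar (n : ℕ) : AddSubgroup (Fin n → ℤ) where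
  carrier := {a | ∑ i, a i = 0}
  zero_mem' := by simp
  add_mem' := by
    intro a b ha hb
    simp only [Set.mem_ofPred_eq] at ha hb ⊢
    simp [Finset.sum_add_distrib, ha, hb]
  neg_mem' := by
    intro a ha
    simp only [Set.mem_ofPred_eq] at ha ⊢
    simp [ha]

/-- The Weyl group of `SL_n` is the symmetric group; it acts on cocharacters by permuting the
diagonal entries. -/
def weylAct {n : ℕ} (w : Equiv.Perm (Fin n)) (a : Cochar n) : Cochar n :=
  ⟨fun i => a.1 (w⁻¹ i), by
    have h : ∑ i, a.1 i = 0 := a.2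
    change ∑ i, a.1 (w⁻¹ i) = 0
    rw [Equiv.sum_comp w⁻¹ a.1, h]⟩

/-- Dominance with respect to the upper triangular Borel subgroup: `⟨α, a⟩ ≥ 0` for each positive
root `α = ε_i - ε_j`, `i < j`. -/
def IsDominant {n : ℕ} (a : Cochar n) : Prop :=
  ∀ i j : Fin n, i < j → 0 ≤ a.1 i - a.1 j

/-- The pairing `⟨ρ, a⟩`, where `ρ` is the half-sum of the positive roots `ε_i - ε_j`, `i < j`. -/
def rhoPairing {n : ℕ} (a : Cochar n) : ℚ :=
  (1 / 2) * ∑ i : Fin n, ∑ j : Fin n, if i < j then ((a.1 i - a.1 j : ℤ) : ℚ) else 0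

/-- The positive coroot `α^∨ : s ↦ diag(s, s⁻¹)` of `SL₂`. -/
def coroot : Cochar 2 :=
  ⟨![1, -1], by change ∑ i, (![1, -1] : Fin 2 → ℤ) i = 0; simp⟩

/-! ### The affine Grassmannian as a set -/

/-- `SL_n(𝒪)` as a subgroup of `SL_n(𝒦)`. -/
def GO (n : ℕ) : Subgroup (SpecialLinearGroup (Fin n) 𝒦) :=
  (SpecialLinearGroup.map (n := Fin n) (HahnSeries.ofPowerSeries ℤ ℂ)).range

/-- The element `t ^ a` of `SL_n(𝒦)` given by a cocharacter `a`. -/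
def tpow {n : ℕ} (a : Cochar n) : SpecialLinearGroup (Fin n) 𝒦 :=
  ⟨Matrix.diagonal fun i => (HahnSeries.single (a.1 i) (1 : ℂ) : 𝒦), by
    have h : ∑ i, a.1 i = 0 := a.2
    have key : ∀ s : Finset (Fin n),
        ∏ i ∈ s, (HahnSeries.single (a.1 i) (1 : ℂ) : 𝒦)
          = HahnSeries.single (∑ i ∈ s, a.1 i) (1 : ℂ) := by
      intro s
      induction s using Finset.induction_on with
      | empty => simp
      | insert i s hi ih =>
        rw [Finset.prod_insert hi, ih, Finset.sum_insert hi, HahnSeries.single_mul_single, mul_one]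
    rw [Matrix.det_diagonal, key, h, HahnSeries.single_zero_one]⟩

/-- The set of points `SL_n(𝒦) / SL_n(𝒪)` of the affine Grassmannian of `SL_n`. -/
def Gr (n : ℕ) : Type := SpecialLinearGroup (Fin n) 𝒦 ⧸ GO n

instance (n : ℕ) : MulAction (SpecialLinearGroup (Fin n) 𝒦) (Gr n) :=
  inferInstanceAs (MulAction (SpecialLinearGroup (Fin n) 𝒦) (SpecialLinearGroup (Fin n) 𝒦 ⧸ GO n))

/-- The class of `g ∈ SL_n(𝒦)` in the affine Grassmannian. -/
def Gr.mk {n : ℕ} (g : SpecialLinearGroup (Fin n) 𝒦) : Gr n :=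
  (QuotientGroup.mk g : SpecialLinearGroup (Fin n) 𝒦 ⧸ GO n)

/-- The point `[a]` of the affine Grassmannian, i.e. the class of `t ^ a`. -/
def Gr.pt {n : ℕ} (a : Cochar n) : Gr n := Gr.mk (tpow a)

/-- `d(L₁, L₂) = a`: the cocharacter `a` is dominant and `(L₁, L₂) = g ([0], [a])` for some
`g ∈ SL_n(𝒦)`. -/
def RelPos {n : ℕ} (L₁ L₂ : Gr n) (a : Cochar n) : Prop :=
  IsDominant a ∧ ∃ g : SpecialLinearGroup (Fin n) 𝒦, L₁ = g • Gr.pt 0 ∧ L₂ = g • Gr.pt a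

/-! ### The Zariski topology on the product of `s` copies of the affine Grassmannian -/

/-- The `s`-fold product of the affine Grassmannian of `SL_n`. -/
def GrProd (s n : ℕ) : Type := Fin s → Gr n

instance (s n : ℕ) : MulAction (SpecialLinearGroup (Fin n) 𝒦) (GrProd s n) :=
  inferInstanceAs (MulAction (SpecialLinearGroup (Fin n) 𝒦) (Fin s → Gr n))

/-- The point of the product given by a tuple of elements of `SL_n(𝒦)`. -/
def GrProd.mk {s n : ℕ} (g : Fin s → SpecialLinearGroup (Fin n) 𝒦) : GrProd s n :=
  fun i => Gr.mk (g i)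

/-- All matrix entries of all `g i` have a pole of order at most `N`. -/
def PoleLE {s n : ℕ} (N : ℕ) (g : Fin s → SpecialLinearGroup (Fin n) 𝒦) : Prop :=
  ∀ (i : Fin s) (a b : Fin n) (k : ℤ), k < -(N : ℤ) → ((g i).1 a b).coeff k = 0

/-- The coordinates of a point of `SL_n(𝒦)^s`: the coefficients of `t ^ k` in all entries. -/
def coord {s n : ℕ} (g : Fin s → SpecialLinearGroup (Fin n) 𝒦) :
    Fin s × Fin n × Fin n × ℤ → ℂ :=
  fun q => ((g q.1).1 q.2.1 q.2.2.1).coeff q.2.2.2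

/-- The Zariski (ind-variety) topology on the product of affine Grassmannians, as the quotient
topology from `SL_n(𝒦)^s`. Here `SL_n(𝒦)^s` is the increasing union over `N` of the sets where
all poles have order at most `N`; the closed subsets of the latter are the zero loci of sets of
polynomials in the coefficients of the entries, and a subset of the union is closed iff its
intersection with each member is closed. -/
instance (s n : ℕ) : TopologicalSpace (GrProd s n) :=
  TopologicalSpace.ofClosed
    {Z : Set (GrProd s n) | ∀ N : ℕ,
      ∃ S : Set (MvPolynomial (Fin s × Fin n × Fin n × ℤ) ℂ),
        ∀ g : Fin s → SpecialLinearGroup (Fin n) 𝒦, PoleLE N g →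
          (GrProd.mk g ∈ Z ↔ ∀ p ∈ S, MvPolynomial.eval (coord g) p = 0)}
    (fun _ => ⟨{1}, fun g _ => by simp⟩)
    (by
      intro A hA N
      choose! S hS using fun Z (hZ : Z ∈ A) => hA hZ N
      refine ⟨⋃ Z ∈ A, S Z, fun g hg => ?_⟩
      simp only [Set.mem_sInter, Set.mem_iUnion]
      constructor
      · rintro h p ⟨Z, hZ, hp⟩
        exact (hS Z hZ g hg).1 (h Z hZ) p hp
      · intro h Z hZ
        exact (hS Z hZ g hg).2 fun p hp => h p ⟨Z, hZ, hp⟩)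
    (by
      intro Z hZ Y hY N
      obtain ⟨S, hS⟩ := hZ N
      obtain ⟨T, hT⟩ := hY N
      refine ⟨{r | ∃ p ∈ S, ∃ q ∈ T, r = p * q}, fun g hg => ?_⟩
      rw [Set.mem_union, hS g hg, hT g hg]
      constructor
      · rintro (h | h) r ⟨p, hp, q, hq, rfl⟩
        · rw [map_mul, h p hp, zero_mul]
        · rw [map_mul, h q hq, mul_zero]
      · intro h
        by_contra hcon
        rw [not_or] at hcon
        obtain ⟨h1, h2⟩ := hcon
        push Not at h1 h2
        obtain ⟨p, hp, hp0⟩ := h1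
        obtain ⟨q, hq, hq0⟩ := h2
        have := h (p * q) ⟨p, hp, q, hq, rfl⟩
        rw [map_mul] at this
        exact (mul_ne_zero hp0 hq0) this)

/-! ### The cyclic convolution variety -/

/-- The cyclic convolution variety `Gr_{c(lam)}` of `SL_n` for a tuple of `s = m + 1` cocharacters:
the tuples `L` with `L_s = [0]` and `d(L_{i-1}, L_i) = lam_i` for all `i`, where `L_0 = L_s`.
Indices are cyclic: in `Fin (m + 1)` the predecessor of the first index is the last one. -/
def cyclicConv {m n : ℕ} (lam : Fin (m + 1) → Cochar n) : Set (GrProd (m + 1) n) :=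
  {L | L (Fin.last m) = Gr.pt 0 ∧ ∀ i : Fin (m + 1), RelPos (L (i - 1)) (L i) (lam i)}

theorem GO_smul_pt_zero {n : ℕ} (g : GO n) :
    (g : SpecialLinearGroup (Fin n) 𝒦) • (Gr.pt 0 : Gr n) = Gr.pt 0 := by
  have h1 : (tpow 0 : SpecialLinearGroup (Fin n) 𝒦) = 1 := by
    apply Subtype.ext
    change Matrix.diagonal (fun i : Fin n => (HahnSeries.single (0 : ℤ) (1 : ℂ) : 𝒦)) = 1
    rw [HahnSeries.single_zero_one, ← Matrix.diagonal_one]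
  unfold Gr.pt Gr.mk
  rw [h1]
  change (QuotientGroup.mk ((g : SpecialLinearGroup (Fin n) 𝒦) * 1) :
    SpecialLinearGroup (Fin n) 𝒦 ⧸ GO n) = QuotientGroup.mk 1
  rw [QuotientGroup.eq]
  simp

theorem GO_smul_mem {m n : ℕ} (lam : Fin (m + 1) → Cochar n) (g : GO n)
    {L : GrProd (m + 1) n} (hL : L ∈ cyclicConv lam) :
    (g : SpecialLinearGroup (Fin n) 𝒦) • L ∈ cyclicConv lam := by
  refine ⟨?_, fun i => ?_⟩
  · change (g : SpecialLinearGroup (Fin n) 𝒦) • L (Fin.last m) = Gr.pt 0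
    rw [hL.1, GO_smul_pt_zero]
  · obtain ⟨hd, k, h1, h2⟩ := hL.2 i
    refine ⟨hd, g * k, ?_, ?_⟩
    · change (g : SpecialLinearGroup (Fin n) 𝒦) • L (i - 1) = _
      rw [h1, mul_smul]
    · change (g : SpecialLinearGroup (Fin n) 𝒦) • L i = _
      rw [h2, mul_smul]

/-- The diagonal left action of `SL_n(𝒪)` on the cyclic convolution variety. -/
instance {m n : ℕ} (lam : Fin (m + 1) → Cochar n) : MulAction (GO n) (cyclicConv lam) where
  smul g L := ⟨(g : SpecialLinearGroup (Fin n) 𝒦) • L.1, GO_smul_mem lam g L.2⟩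
  one_smul L := Subtype.ext (one_smul (SpecialLinearGroup (Fin n) 𝒦) L.1)
  mul_smul g h L := Subtype.ext (mul_smul (g : SpecialLinearGroup (Fin n) 𝒦) h L.1)

/-! ### The Lie algebra of the stabilizer of a point -/

/-- The inclusion of `SL_n(𝒦)` in `SL_n(𝒦[ε])`. -/
def toDual {n : ℕ} :
    SpecialLinearGroup (Fin n) 𝒦 →* SpecialLinearGroup (Fin n) (DualNumber 𝒦) :=
  SpecialLinearGroup.map (TrivSqZeroExt.inlHom 𝒦 𝒦)

/-- Membership of an element of `SL_n(𝒦[ε])` in `SL_n(𝒪[ε])`. -/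
def IsIntegralDual {n : ℕ} (γ : SpecialLinearGroup (Fin n) (DualNumber 𝒦)) : Prop :=
  ∀ a b, (γ.1 a b).fst ∈ (HahnSeries.ofPowerSeries ℤ ℂ).range ∧
    (γ.1 a b).snd ∈ (HahnSeries.ofPowerSeries ℤ ℂ).range

/-- The `ℂ[ε]`-points of the stabilizer in `SL_n(𝒪)` of a tuple of points `x i = g i • [0]`, i.e.
of the intersection of `SL_n(𝒪)` with all the `g i SL_n(𝒪) (g i)⁻¹`. -/
def IsStabDual {s n : ℕ} (x : GrProd s n) (γ : SpecialLinearGroup (Fin n) (DualNumber 𝒦)) : Prop :=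
  IsIntegralDual γ ∧ ∀ (i : Fin s) (g : SpecialLinearGroup (Fin n) 𝒦), Gr.mk g = x i →
    IsIntegralDual ((toDual g)⁻¹ * γ * toDual g)

/-- The matrix `1 + e M` over a commutative ring. -/
def oneAdd {n : ℕ} {S : Type} [CommRing S] (e : S) (M : Matrix (Fin n) (Fin n) S) :
    Matrix (Fin n) (Fin n) S :=
  1 + e • M

/-- The matrix `1 + ε X` over `𝒦[ε]`, for a matrix `X` over `𝒪`. -/
def oneAddEps {n : ℕ} (X : Matrix (Fin n) (Fin n) 𝒪) : Matrix (Fin n) (Fin n) (DualNumber 𝒦) :=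
  oneAdd DualNumber.eps
    ((X.map (HahnSeries.ofPowerSeries ℤ ℂ)).map (TrivSqZeroExt.inlHom 𝒦 𝒦))

theorem mul_smul_mul {n : ℕ} {R : Type} [CommRing R] (P Q Y : Matrix (Fin n) (Fin n) R) (r : R) :
    P * (r • Y) * Q = r • (P * Y * Q) := by
  rw [Matrix.mul_smul, Matrix.smul_mul]

theorem conj_oneAdd {n : ℕ} {R S : Type} [CommRing R] [CommRing S] (f : R →+* S)
    (P Q Y : Matrix (Fin n) (Fin n) R) (h : P * Q = 1) (e : S) :
    P.map f * oneAdd e (Y.map f) * Q.map f = oneAdd e ((P * Y * Q).map f) := by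
  unfold oneAdd
  rw [Matrix.mul_add, Matrix.add_mul, Matrix.mul_one, mul_smul_mul, ← Matrix.map_mul,
    ← Matrix.map_mul, ← Matrix.map_mul, h, Matrix.map_one _ (map_zero _) (map_one _)]

theorem det_oneAdd {n : ℕ} {S : Type} [CommRing S] (e : S) (he : e * e = 0)
    (M : Matrix (Fin n) (Fin n) S) (hM : M.trace = 0) : (oneAdd e M).det = 1 := by
  unfold oneAdd
  rw [Matrix.det_one_add_smul, hM, pow_two, he]
  simp

theorem oneAdd_apply {n : ℕ} {S : Type} [CommRing S] (e : S) (M : Matrix (Fin n) (Fin n) S)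
    (a b : Fin n) : oneAdd e M a b = (if a = b then 1 else 0) + e * M a b := by
  simp [oneAdd, Matrix.one_apply]

theorem det_oneAddEps {n : ℕ} (X : Matrix (Fin n) (Fin n) 𝒪) (hX : X.trace = 0) :
    (oneAddEps X).det = 1 := by
  refine det_oneAdd _ DualNumber.eps_mul_eps _ ?_
  have := congrArg (fun f => TrivSqZeroExt.inlHom 𝒦 𝒦 (HahnSeries.ofPowerSeries ℤ ℂ f)) hX
  simpa [Matrix.trace, map_sum] using this

/-- The element `1 + ε X` lies in the stabilizer iff `X` lies in `Ad_g` of integral matrices for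
all representatives `g`. -/
theorem isStabDual_iff {s n : ℕ} (x : GrProd s n) (X : Matrix (Fin n) (Fin n) 𝒪)
    (hX : X.trace = 0) :
    (∃ γ, IsStabDual x γ ∧ (γ : Matrix (Fin n) (Fin n) (DualNumber 𝒦)) = oneAddEps X) ↔
      ∀ (i : Fin s) (g : SpecialLinearGroup (Fin n) 𝒦), Gr.mk g = x i → ∀ a b,
        ((↑g⁻¹ : Matrix (Fin n) (Fin n) 𝒦) * X.map (HahnSeries.ofPowerSeries ℤ ℂ) *
          (g : Matrix (Fin n) (Fin n) 𝒦)) a b ∈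
          (HahnSeries.ofPowerSeries ℤ ℂ).range := by
  have hmul : ∀ g : SpecialLinearGroup (Fin n) 𝒦,
      (↑(toDual g)⁻¹ : Matrix (Fin n) (Fin n) (DualNumber 𝒦)) * oneAddEps X *
          (toDual g : Matrix (Fin n) (Fin n) (DualNumber 𝒦)) =
        oneAdd DualNumber.eps
          (((↑g⁻¹ : Matrix (Fin n) (Fin n) 𝒦) * X.map (HahnSeries.ofPowerSeries ℤ ℂ) *
          (g : Matrix (Fin n) (Fin n) 𝒦)).map
            (TrivSqZeroExt.inlHom 𝒦 𝒦)) := by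
    intro g
    have h3 : (↑g⁻¹ : Matrix (Fin n) (Fin n) 𝒦) * (g : Matrix (Fin n) (Fin n) 𝒦) = 1 :=
      congrArg Subtype.val (inv_mul_cancel g)
    have h1 : (↑(toDual g)⁻¹ : Matrix (Fin n) (Fin n) (DualNumber 𝒦)) =
        (↑g⁻¹ : Matrix (Fin n) (Fin n) 𝒦).map (TrivSqZeroExt.inlHom 𝒦 𝒦) := by
      rw [← map_inv]; rfl
    have h2 : (toDual g : Matrix (Fin n) (Fin n) (DualNumber 𝒦)) =
        (g : Matrix (Fin n) (Fin n) 𝒦).map (TrivSqZeroExt.inlHom 𝒦 𝒦) := rfl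
    rw [oneAddEps, h1, h2]
    have h4 := conj_oneAdd (R := 𝒦) (S := DualNumber 𝒦) (TrivSqZeroExt.inlHom 𝒦 𝒦)
      (↑g⁻¹ : Matrix (Fin n) (Fin n) 𝒦) (g : Matrix (Fin n) (Fin n) 𝒦)
      (X.map (HahnSeries.ofPowerSeries ℤ ℂ)) h3 DualNumber.eps
    exact h4
  have hfst : ∀ (Y : Matrix (Fin n) (Fin n) 𝒦) (a b),
      (oneAdd (DualNumber.eps : DualNumber 𝒦) (Y.map (TrivSqZeroExt.inlHom 𝒦 𝒦)) a b).fst = if a = b then 1 else 0 := by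
    intro Y a b
    rw [oneAdd_apply]
    by_cases h : a = b <;> simp [h]
  have hsnd : ∀ (Y : Matrix (Fin n) (Fin n) 𝒦) (a b),
      (oneAdd (DualNumber.eps : DualNumber 𝒦) (Y.map (TrivSqZeroExt.inlHom 𝒦 𝒦)) a b).snd = Y a b := by
    intro Y a b
    rw [oneAdd_apply]
    by_cases h : a = b <;> simp [h]
  have hone : ∀ a b : Fin n, (if a = b then (1 : 𝒦) else 0) ∈
      (HahnSeries.ofPowerSeries ℤ ℂ).range := by
    intro a b
    split_ifs
    · exact one_mem _
    · exact zero_mem _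
  constructor
  · rintro ⟨γ, ⟨-, h⟩, hγ⟩ i g hg a b
    have h1 := (h i g hg a b).2
    have h2 : (↑((toDual g)⁻¹ * γ * toDual g) : Matrix (Fin n) (Fin n) (DualNumber 𝒦)) = (↑(toDual g)⁻¹ : Matrix (Fin n) (Fin n) (DualNumber 𝒦)) * oneAddEps X * (toDual g : Matrix (Fin n) (Fin n) (DualNumber 𝒦)) := by
      rw [← hγ]; rfl
    rw [h2, hmul, hsnd] at h1
    exact h1
  · intro h
    refine ⟨⟨oneAddEps X, det_oneAddEps X hX⟩, ⟨?_, ?_⟩, rfl⟩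
    · intro a b
      change ((oneAddEps X) a b).fst ∈ _ ∧ ((oneAddEps X) a b).snd ∈ _
      rw [oneAddEps, hfst, hsnd]
      exact ⟨hone a b, ⟨X a b, rfl⟩⟩
    · intro i g hg a b
      change (((↑(toDual g)⁻¹ : Matrix (Fin n) (Fin n) (DualNumber 𝒦)) * oneAddEps X * (toDual g : Matrix (Fin n) (Fin n) (DualNumber 𝒦))) a b).fst ∈ _ ∧
        (((↑(toDual g)⁻¹ : Matrix (Fin n) (Fin n) (DualNumber 𝒦)) * oneAddEps X * (toDual g : Matrix (Fin n) (Fin n) (DualNumber 𝒦))) a b).snd ∈ _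
      rw [hmul, hfst, hsnd]
      exact ⟨hone a b, h i g hg a b⟩

theorem sl_trace {n : ℕ} (X : LieAlgebra.SpecialLinear.sl (Fin n) 𝒪) : X.1.trace = 0 := by
  simpa [LieAlgebra.SpecialLinear.sl] using X.2

/-- The Lie algebra of the stabilizer in `SL_n(𝒪)` of a tuple of points of the affine
Grassmannian, inside `sl_n(𝒪)`: those `X` for which `1 + ε X` is a `ℂ[ε]`-point of the
stabilizer. -/
def lieStab {s n : ℕ} (x : GrProd s n) :
    Submodule ℂ (LieAlgebra.SpecialLinear.sl (Fin n) 𝒪) where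
  carrier := {X | ∃ γ, IsStabDual x γ ∧ (γ : Matrix (Fin n) (Fin n) (DualNumber 𝒦)) = oneAddEps X.1}
  zero_mem' := by
    rw [Set.mem_ofPred_eq, isStabDual_iff x _ (sl_trace 0)]
    intro i g _ a b
    have h : ((0 : LieAlgebra.SpecialLinear.sl (Fin n) 𝒪)).1.map
        (HahnSeries.ofPowerSeries ℤ ℂ) = 0 := by
      refine Matrix.ext fun a b => ?_
      exact map_zero (HahnSeries.ofPowerSeries ℤ ℂ)
    rw [h, Matrix.mul_zero, Matrix.zero_mul]
    exact zero_mem _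
  add_mem' := by
    intro X Y hX hY
    rw [Set.mem_ofPred_eq, isStabDual_iff x _ (sl_trace _)] at hX hY ⊢
    intro i g hg a b
    have h : (X + Y).1.map (HahnSeries.ofPowerSeries ℤ ℂ) =
        X.1.map (HahnSeries.ofPowerSeries ℤ ℂ) + Y.1.map (HahnSeries.ofPowerSeries ℤ ℂ) := by
      refine Matrix.ext fun a b => ?_
      exact map_add (HahnSeries.ofPowerSeries ℤ ℂ) _ _
    rw [h, Matrix.mul_add, Matrix.add_mul]
    exact add_mem (hX i g hg a b) (hY i g hg a b)
  smul_mem' := by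
    intro c X hX
    rw [Set.mem_ofPred_eq, isStabDual_iff x _ (sl_trace _)] at hX ⊢
    intro i g hg a b
    have h : (c • X).1.map (HahnSeries.ofPowerSeries ℤ ℂ) =
        (HahnSeries.ofPowerSeries ℤ ℂ (PowerSeries.C c)) •
          X.1.map (HahnSeries.ofPowerSeries ℤ ℂ) := by
      refine Matrix.ext fun a b => ?_
      change HahnSeries.ofPowerSeries ℤ ℂ (c • X.1 a b) = _
      rw [PowerSeries.smul_eq_C_mul, map_mul]
      rfl
    have hX' := hX i g hg a b
    rw [h]
    have e := congrFun₂ (mul_smul_mul (↑g⁻¹ : Matrix (Fin n) (Fin n) 𝒦) (g : Matrix (Fin n) (Fin n) 𝒦)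
      (X.1.map (HahnSeries.ofPowerSeries ℤ ℂ)) (HahnSeries.ofPowerSeries ℤ ℂ (PowerSeries.C c))) a b
    refine (congrArg (· ∈ (HahnSeries.ofPowerSeries ℤ ℂ).range) e).mpr ?_
    exact mul_mem ⟨_, rfl⟩ hX'

/-! ### The point of the example -/

/-- The matrix `[[1, t], [0, 1]]`. -/
def unip : SpecialLinearGroup (Fin 2) 𝒦 :=
  ⟨!![1, HahnSeries.single 1 1; 0, 1], by simp [Matrix.det_fin_two]⟩

/-- The triple `([α^∨], [[1, t], [0, 1]] t^{α^∨} SL₂(𝒪), [0])`. -/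
def examplePoint : GrProd 3 2 :=
  ![Gr.pt coroot, Gr.mk (unip * tpow coroot), Gr.pt 0]

end CyclicConvolution

end

/-!
A point of the affine Grassmannian of `SL₂` at distance `α^∨` from `[0]` is a vertex at distance
two from `[0]` in the Bruhat-Tits tree. In a triangle whose three sides all have type `α^∨`, the
paths joining the vertices pass through a common midpoint `P`, a neighbour of `[0]`. So the cyclic
convolution variety is the space of `P ∈ ℙ¹` together with two distinct points of the affine line
`ℙ¹(P) ∖ {[0]}`, where `ℙ¹(P)` is the set of neighbours of `P`. It has dimension `3`, and
`SL₂(𝒪)` acts transitively on it, because it acts transitively on `ℙ¹` and the stabilizer of `P`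
acts on this affine line through the full affine group (`orbit_exampleTriangle`). Hence the orbit of the point in question is the whole variety,
and what is left is to prove that the variety is irreducible of Krull dimension `3`.

For `P ≠ ∞` the triangles are `([[1, p + a t], [0, 1]] t ^ α^∨, [[1, p + (a + c) t], [0, 1]]
t ^ α^∨, [0])` with `c ≠ 0`. The map `chart` from `{c ≠ 0} ⊆ 𝔸³` given by these formulas is an open
embedding (`isOpenEmbedding_chart`): it is continuous as its entries are polynomial, and on any
representatives of the vertices `p`, `a`, `c` are quotients of polynomials in the coefficients of
the entries, so clearing denominators turns closed conditions on `(p, a, c)` into closed conditions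
on triangles. That the latter do not depend on representatives is arranged by imposing them on all
representatives at once (`isClosed_setOf_forall_eval_eq_zero`). The chart and its translate by the
Weyl group cover the variety, which gives irreducibility and reduces the dimension to that of
`{c ≠ 0}`: at most `3` because the topology is induced from the spectrum of a polynomial ring in
three variables, and at least `3` because of a chain of coordinate subspaces.

The Lie algebra of the stabilizer is found by conjugating a traceless matrix with representatives of
the vertices.
-/

noncomputable section

namespace CyclicConvolution

/-! ### The Zariski topology on products of affine Grassmannians -/

theorem isClosed_iff {s n : ℕ} {Z : Set (GrProd s n)} :
    IsClosed Z ↔ ∀ N : ℕ, ∃ S : Set (MvPolynomial (Fin s × Fin n × Fin n × ℤ) ℂ),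
      ∀ g : Fin s → SpecialLinearGroup (Fin n) 𝒦, PoleLE N g →
        (GrProd.mk g ∈ Z ↔ ∀ p ∈ S, MvPolynomial.eval (coord g) p = 0) := by
  rw [← isOpen_compl_iff]
  change (Zᶜ)ᶜ ∈ {Z : Set (GrProd s n) | _} ↔ _
  rw [compl_compl]
  rfl

theorem Gr.mk_eq_mk {n : ℕ} {g h : SpecialLinearGroup (Fin n) 𝒦} :
    Gr.mk g = Gr.mk h ↔ g⁻¹ * h ∈ GO n :=
  QuotientGroup.eq

theorem smul_mk {s n : ℕ} (k : SpecialLinearGroup (Fin n) 𝒦)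
    (g : Fin s → SpecialLinearGroup (Fin n) 𝒦) :
    k • GrProd.mk g = GrProd.mk fun i => k * g i :=
  rfl

theorem Gr.smul_mk {n : ℕ} (k g : SpecialLinearGroup (Fin n) 𝒦) :
    k • Gr.mk g = Gr.mk (k * g) :=
  rfl

theorem mul_val_apply {n : ℕ} (g h : SpecialLinearGroup (Fin n) 𝒦) (a b : Fin n) :
    (g * h).1 a b = ∑ j, g.1 a j * h.1 j b :=
  Matrix.mul_apply

/-- A coefficient of `x * y` is a fixed finite linear combination of coefficients of `x`, as long
as `y` is fixed and the pole order of `x` is bounded. -/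
theorem exists_finset_coeff_mul (N : ℕ) (y : 𝒦) (k : ℤ) :
    ∃ F : Finset (ℤ × ℤ), ∀ x : 𝒦, (∀ j : ℤ, j < -(N : ℤ) → x.coeff j = 0) →
      (x * y).coeff k = ∑ ij ∈ F, x.coeff ij.1 * y.coeff ij.2 := by
  have hs : (Set.Ici (-(N : ℤ))).IsPWO :=
    (BddBelow.isWF bddBelow_Ici).isPWO
  refine ⟨Finset.antidiagonal hs y.isPWO_support k, fun x hx => ?_⟩
  refine HahnSeries.coeff_mul_left' hs fun j hj => ?_
  by_contra hlt
  exact hj (hx j (not_le.1 hlt))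

theorem coeff_mul_eq_zero {x y : 𝒦} {M N k : ℤ} (hx : ∀ j < M, x.coeff j = 0)
    (hy : ∀ j < N, y.coeff j = 0) (hk : k < M + N) : (x * y).coeff k = 0 := by
  rw [HahnSeries.coeff_mul]
  refine Finset.sum_eq_zero fun ij hij => ?_
  rw [Finset.mem_antidiagonal] at hij
  rcases lt_or_ge ij.1 M with h | h
  · rw [hx _ h, zero_mul]
  · rw [hy _ (by omega), mul_zero]

theorem exists_poleLE {s n : ℕ} (g : Fin s → SpecialLinearGroup (Fin n) 𝒦) :
    ∃ N : ℕ, PoleLE N g := by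
  refine ⟨∑ i, ∑ a, ∑ b, ((g i).1 a b).order.natAbs, fun i a b k hk => ?_⟩
  refine HahnSeries.coeff_eq_zero_of_lt_order (hk.trans_le ?_)
  have h1 : ((g i).1 a b).order.natAbs ≤ ∑ b, ((g i).1 a b).order.natAbs :=
    Finset.single_le_sum (f := fun b => ((g i).1 a b).order.natAbs)
      (fun _ _ => Nat.zero_le _) (Finset.mem_univ b)
  have h2 : _ ≤ ∑ a, ∑ b, ((g i).1 a b).order.natAbs :=
    Finset.single_le_sum (f := fun a => ∑ b, ((g i).1 a b).order.natAbs)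
      (fun _ _ => Nat.zero_le _) (Finset.mem_univ a)
  have h3 : _ ≤ ∑ i, ∑ a, ∑ b, ((g i).1 a b).order.natAbs :=
    Finset.single_le_sum (f := fun i => ∑ a, ∑ b, ((g i).1 a b).order.natAbs)
      (fun _ _ => Nat.zero_le _) (Finset.mem_univ i)
  omega

theorem PoleLE.mul {s n M N : ℕ} {g h : Fin s → SpecialLinearGroup (Fin n) 𝒦}
    (hg : PoleLE M g) (hh : PoleLE N h) : PoleLE (M + N) fun i => g i * h i := by
  intro i a b k hk
  change ((g i * h i).1 a b).coeff k = 0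
  rw [mul_val_apply, HahnSeries.coeff_sum]
  refine Finset.sum_eq_zero fun j _ => coeff_mul_eq_zero (hg i a j) (hh i j b) ?_
  push_cast at hk
  omega

/-- On tuples of bounded pole order, right translation by a fixed tuple is polynomial in the
coordinates. -/
theorem exists_coord_mul_right {s n : ℕ} (N : ℕ) (h : Fin s → SpecialLinearGroup (Fin n) 𝒦) :
    ∃ P : Fin s × Fin n × Fin n × ℤ → MvPolynomial (Fin s × Fin n × Fin n × ℤ) ℂ,
      ∀ g : Fin s → SpecialLinearGroup (Fin n) 𝒦, PoleLE N g →
        ∀ q, coord (fun i => g i * h i) q = MvPolynomial.eval (coord g) (P q) := by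
  choose F hF using exists_finset_coeff_mul N
  refine ⟨fun q => ∑ j, ∑ ij ∈ F ((h q.1).1 j q.2.2.1) q.2.2.2,
    MvPolynomial.X (q.1, q.2.1, j, ij.1) * MvPolynomial.C (((h q.1).1 j q.2.2.1).coeff ij.2),
    fun g hg q => ?_⟩
  rw [coord, mul_val_apply, HahnSeries.coeff_sum, map_sum]
  refine Finset.sum_congr rfl fun j _ => ?_
  rw [map_sum, hF _ _ _ (hg _ _ _)]
  simp [coord]

/-- On tuples of bounded pole order, left translation by a fixed tuple is polynomial in the
coordinates. -/
theorem exists_coord_mul_left {s n : ℕ} (N : ℕ) (h : Fin s → SpecialLinearGroup (Fin n) 𝒦) :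
    ∃ P : Fin s × Fin n × Fin n × ℤ → MvPolynomial (Fin s × Fin n × Fin n × ℤ) ℂ,
      ∀ g : Fin s → SpecialLinearGroup (Fin n) 𝒦, PoleLE N g →
        ∀ q, coord (fun i => h i * g i) q = MvPolynomial.eval (coord g) (P q) := by
  choose F hF using exists_finset_coeff_mul N
  refine ⟨fun q => ∑ j, ∑ ij ∈ F ((h q.1).1 q.2.1 j) q.2.2.2,
    MvPolynomial.X (q.1, j, q.2.2.1, ij.1) * MvPolynomial.C (((h q.1).1 q.2.1 j).coeff ij.2),
    fun g hg q => ?_⟩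
  rw [coord, mul_val_apply, HahnSeries.coeff_sum, map_sum]
  refine Finset.sum_congr rfl fun j _ => ?_
  rw [map_sum, mul_comm, hF _ _ _ (hg _ _ _)]
  simp [coord]

theorem eval_bind₁_of_eq {σ τ : Type*} {x : σ → ℂ} {y : τ → ℂ} {P : τ → MvPolynomial σ ℂ}
    (h : ∀ q, y q = MvPolynomial.eval x (P q)) (p : MvPolynomial τ ℂ) :
    MvPolynomial.eval x (MvPolynomial.bind₁ P p) = MvPolynomial.eval y p := by
  have hy : y = fun q => MvPolynomial.eval x (P q) := funext h
  rw [hy]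
  exact MvPolynomial.eval₂Hom_bind₁ (RingHom.id ℂ) x P p

instance (s n : ℕ) :
    ContinuousConstSMul (SpecialLinearGroup (Fin n) 𝒦) (GrProd s n) where
  continuous_const_smul k := by
    refine continuous_iff_isClosed.2 fun Z hZ => isClosed_iff.2 fun N => ?_
    obtain ⟨M, hM⟩ := exists_poleLE fun _ : Fin s => k
    obtain ⟨S, hS⟩ := isClosed_iff.1 hZ (M + N)
    obtain ⟨P, hP⟩ := exists_coord_mul_left N fun _ : Fin s => k
    refine ⟨MvPolynomial.bind₁ P '' S, fun g hg => ?_⟩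
    rw [Set.mem_preimage, smul_mk, hS _ (hM.mul hg), Set.forall_mem_image]
    refine forall₂_congr fun p _ => ?_
    rw [eval_bind₁_of_eq (hP g hg)]

/-- Any set of polynomials cuts out a closed subset of the product of affine Grassmannians, namely
the set of points all of whose representatives are zeros of all the polynomials. -/
theorem isClosed_setOf_forall_eval_eq_zero {s n : ℕ}
    (S : Set (MvPolynomial (Fin s × Fin n × Fin n × ℤ) ℂ)) :
    IsClosed {L : GrProd s n | ∀ g, GrProd.mk g = L → ∀ p ∈ S,
      MvPolynomial.eval (coord g) p = 0} := by
  refine isClosed_iff.2 fun N => ?_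
  choose P hP using exists_coord_mul_right (s := s) (n := n) N
  refine ⟨{r | ∃ h : Fin s → SpecialLinearGroup (Fin n) 𝒦, (∀ i, h i ∈ GO n) ∧
    ∃ p ∈ S, r = MvPolynomial.bind₁ (P h) p}, fun g hg => ⟨?_, ?_⟩⟩
  · rintro hL r ⟨h, hh, p, hp, rfl⟩
    rw [eval_bind₁_of_eq (hP h g hg)]
    refine hL _ (funext fun i => Gr.mk_eq_mk.2 ?_) p hp
    simpa using hh i
  · intro hr g' hg' p hp
    have h1 : ∀ i, (g i)⁻¹ * g' i ∈ GO n := fun i =>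
      Gr.mk_eq_mk.1 (congrFun hg'.symm i)
    have h2 := hr _ ⟨fun i => (g i)⁻¹ * g' i, h1, p, hp, rfl⟩
    rw [eval_bind₁_of_eq (hP _ g hg)] at h2
    simpa using h2

/-! ### Krull dimension and open charts -/

/-- The Krull dimension may be computed on open charts: a chain of irreducible closed subsets
restricts to a chain of the same length on any chart that meets its smallest member. -/
theorem topologicalKrullDim_le_of_forall_exists_isOpenEmbedding {X Y : Type*} [TopologicalSpace X]
    [TopologicalSpace Y] (h : ∀ x : X, ∃ f : Y → X, Topology.IsOpenEmbedding f ∧ x ∈ Set.range f) :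
    topologicalKrullDim X ≤ topologicalKrullDim Y := by
  refine iSup_le fun c => ?_
  obtain ⟨x, hx⟩ := c.head.isIrreducible.nonempty
  obtain ⟨f, hf, y, rfl⟩ := h x
  have hmem : ∀ i, c i ∈
      {V : TopologicalSpace.IrreducibleCloseds X | (f ⁻¹' (V : Set X)).Nonempty} := fun i =>
    ⟨y, (LTSeries.head_le c i : c.head ≤ c i) hx⟩
  let e := TopologicalSpace.IrreducibleCloseds.orderIsoOfIsOpenEmbedding f hf
  let d : LTSeries (TopologicalSpace.IrreducibleCloseds Y) :=
    LTSeries.mk c.length (fun i => e.symm ⟨c i, hmem i⟩) fun i j hij =>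
      e.symm.strictMono (c.strictMono hij)
  exact le_iSup (fun p : LTSeries (TopologicalSpace.IrreducibleCloseds Y) =>
    ((p.length : ℕ∞) : WithBot ℕ∞)) d

/-- A space covered by the ranges of two overlapping open embeddings of irreducible spaces is
irreducible. -/
theorem irreducibleSpace_of_isOpenEmbedding {X Y : Type*} [TopologicalSpace X]
    [TopologicalSpace Y] [IrreducibleSpace Y] {f g : Y → X} (hf : Topology.IsOpenEmbedding f)
    (hg : Topology.IsOpenEmbedding g) (hfg : (Set.range f ∩ Set.range g).Nonempty)
    (h : Set.range f ∪ Set.range g = Set.univ) : IrreducibleSpace X := by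
  have hirr : ∀ k : Y → X, Topology.IsOpenEmbedding k → IsIrreducible (Set.range k) := by
    intro k hk
    rw [← Set.image_univ]
    exact (IrreducibleSpace.isIrreducible_univ Y).image k hk.continuous.continuousOn
  -- An open set meeting one of the charts meets the intersection of the two charts.
  have key : ∀ U : Set X, IsOpen U → U.Nonempty → (Set.range f ∩ U).Nonempty := by
    rintro U hU ⟨u, hu⟩
    rcases h.symm ▸ Set.mem_univ u with hu' | hu'
    · exact ⟨u, hu', hu⟩
    · obtain ⟨z, hz1, hz2⟩ := hfg
      obtain ⟨w, -, hw, hw'⟩ := (hirr g hg).isPreirreducible _ _ hf.isOpen_range hU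
        ⟨z, hz2, hz1⟩ ⟨u, hu', hu⟩
      exact ⟨w, hw, hw'⟩
  have hne : Nonempty X := ⟨hfg.some⟩
  have : PreirreducibleSpace X := ⟨fun U V hU hV hU' hV' => by
    obtain ⟨w, -, hw⟩ := (hirr f hf).isPreirreducible U V hU hV
      (key U hU (by simpa using hU')) (key V hV (by simpa using hV'))
    exact ⟨w, Set.mem_univ w, hw⟩⟩
  exact { toNonempty := hne }

/-! ### The chart domain -/

/-- The complement of the hyperplane `x₂ = 0` in affine `3`-space over `ℂ`. -/
def ChartDomain : Type := {x : Fin 3 → ℂ // x 2 ≠ 0}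

/-- The coordinates of a point. -/
def ChartDomain.val (x : ChartDomain) : Fin 3 → ℂ := Subtype.val x

theorem ChartDomain.val_injective : Function.Injective ChartDomain.val := Subtype.val_injective

/-- The Zariski topology, induced from the spectrum of the polynomial ring. -/
instance : TopologicalSpace ChartDomain :=
  TopologicalSpace.induced
    (fun x => (MvPolynomial.pointToPoint x.val : PrimeSpectrum (MvPolynomial (Fin 3) ℂ)))
    inferInstance

namespace ChartDomain

theorem isClosed_iff {Z : Set ChartDomain} :
    IsClosed Z ↔ ∃ S : Set (MvPolynomial (Fin 3) ℂ),
      ∀ x : ChartDomain, x ∈ Z ↔ ∀ p ∈ S, MvPolynomial.eval x.val p = 0 := by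
  have hmem : ∀ (S : Set (MvPolynomial (Fin 3) ℂ)) (x : ChartDomain),
      (MvPolynomial.pointToPoint x.val : PrimeSpectrum (MvPolynomial (Fin 3) ℂ)) ∈
        PrimeSpectrum.zeroLocus S ↔ ∀ p ∈ S, MvPolynomial.eval x.val p = 0 := by
    intro S x
    rw [PrimeSpectrum.mem_zeroLocus]
    refine forall₂_congr fun p _ => ?_
    change p ∈ MvPolynomial.vanishingIdeal ℂ {x.val} ↔ _
    rw [MvPolynomial.mem_vanishingIdeal_singleton_iff]
    rfl
  rw [isClosed_induced_iff]
  constructor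
  · rintro ⟨T, hT, rfl⟩
    obtain ⟨S, rfl⟩ := (PrimeSpectrum.isClosed_iff_zeroLocus T).1 hT
    exact ⟨S, fun x => hmem S x⟩
  · rintro ⟨S, hS⟩
    refine ⟨_, PrimeSpectrum.isClosed_zeroLocus S, Set.ext fun x => ?_⟩
    rw [Set.mem_preimage, hmem, hS]

theorem topologicalKrullDim_le : topologicalKrullDim ChartDomain ≤ 3 := by
  refine (Topology.IsInducing.topologicalKrullDim_le ⟨rfl⟩ :
    _ ≤ topologicalKrullDim (PrimeSpectrum (MvPolynomial (Fin 3) ℂ))).trans ?_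
  rw [PrimeSpectrum.topologicalKrullDim_eq_ringKrullDim,
    MvPolynomial.ringKrullDim_of_isNoetherianRing, ringKrullDim_eq_zero_of_field]
  simp

instance : IrreducibleSpace ChartDomain := by
  have hne : Nonempty ChartDomain := ⟨⟨fun _ => 1, one_ne_zero⟩⟩
  have : PreirreducibleSpace ChartDomain := by
    refine ⟨isPreirreducible_iff_isClosed_union_isClosed.2 fun Z W hZ hW hZW => ?_⟩
    obtain ⟨S, hS⟩ := isClosed_iff.1 hZ
    obtain ⟨T, hT⟩ := isClosed_iff.1 hW
    by_contra! hcon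
    obtain ⟨⟨x, -, hx⟩, ⟨y, -, hy⟩⟩ := And.intro
      (Set.not_subset.1 hcon.1) (Set.not_subset.1 hcon.2)
    rw [hS] at hx
    rw [hT] at hy
    push Not at hx hy
    obtain ⟨p, hp, hpx⟩ := hx
    obtain ⟨q, hq, hqy⟩ := hy
    -- `p * q * X₂` vanishes on all of affine space, although none of its factors does.
    have hzero : p * q * MvPolynomial.X 2 = 0 := by
      refine MvPolynomial.funext fun z => ?_
      rw [map_mul, map_mul, MvPolynomial.eval_X, map_zero]
      by_cases hz : z 2 = 0
      · rw [hz, mul_zero]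
      · rcases hZW (Set.mem_univ (⟨z, hz⟩ : ChartDomain)) with h | h
        · have h1 : MvPolynomial.eval z p = 0 := (hS _).1 h p hp
          rw [h1, zero_mul, zero_mul]
        · have h1 : MvPolynomial.eval z q = 0 := (hT _).1 h q hq
          rw [h1, mul_zero, zero_mul]
    rcases mul_eq_zero.1 hzero with h | h
    · rcases mul_eq_zero.1 h with h | h
      · exact hpx (by rw [h, map_zero])
      · exact hqy (by rw [h, map_zero])
    · exact MvPolynomial.X_ne_zero 2 h
  exact { toNonempty := hne }

/-- The map setting the coordinates in a given set equal to `1`. -/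
def setOne (A : Set (Fin 3)) [DecidablePred (· ∈ A)] (x : ChartDomain) : ChartDomain :=
  ⟨fun i => if i ∈ A then 1 else x.val i, by
    beta_reduce
    split_ifs
    · exact one_ne_zero
    · exact x.2⟩

theorem setOne_val (A : Set (Fin 3)) [DecidablePred (· ∈ A)] (x : ChartDomain) (i : Fin 3) :
    (setOne A x).val i = if i ∈ A then 1 else x.val i := rfl

theorem continuous_setOne (A : Set (Fin 3)) [DecidablePred (· ∈ A)] :
    Continuous (setOne A) := by
  refine continuous_iff_isClosed.2 fun Z hZ => ?_
  obtain ⟨S, hS⟩ := isClosed_iff.1 hZ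
  let P : Fin 3 → MvPolynomial (Fin 3) ℂ := fun i => if i ∈ A then 1 else MvPolynomial.X i
  refine isClosed_iff.2 ⟨MvPolynomial.bind₁ P '' S, fun x => ?_⟩
  rw [Set.mem_preimage, hS, Set.forall_mem_image]
  refine forall₂_congr fun p _ => ?_
  rw [eval_bind₁_of_eq (y := (setOne A x).val)]
  intro i
  by_cases hi : i ∈ A <;> simp [P, hi, setOne_val]

/-- The coordinate subspace where the coordinates in a given set are equal to `1`. -/
def coordSubspace (A : Set (Fin 3)) [DecidablePred (· ∈ A)] :
    TopologicalSpace.IrreducibleCloseds ChartDomain where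
  carrier := {x | ∀ i ∈ A, x.val i = 1}
  isIrreducible' := by
    have h : {x : ChartDomain | ∀ i ∈ A, x.val i = 1} = setOne A '' Set.univ := by
      ext x
      constructor
      · intro hx
        refine ⟨x, Set.mem_univ x, val_injective (funext fun i => ?_)⟩
        by_cases hi : i ∈ A
        · simp [setOne_val, hi, hx i hi]
        · simp [setOne_val, hi]
      · rintro ⟨y, -, rfl⟩ i hi
        simp [setOne_val, hi]
    rw [h]
    exact (IrreducibleSpace.isIrreducible_univ _).image _ (continuous_setOne A).continuousOn
  isClosed' := by
    refine isClosed_iff.2 ⟨(fun i => MvPolynomial.X i - 1) '' A, fun x => ?_⟩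
    simp [sub_eq_zero]

theorem coordSubspace_lt {A B : Set (Fin 3)} [DecidablePred (· ∈ A)] [DecidablePred (· ∈ B)]
    (h : A ⊂ B) : coordSubspace B < coordSubspace A := by
  obtain ⟨i, hiB, hiA⟩ := Set.exists_of_ssubset h
  refine lt_of_le_not_ge (fun x hx j hj => hx j (h.1 hj)) fun hle => ?_
  obtain ⟨y, hy⟩ : ∃ y : ChartDomain, ∀ i, y.val i = 2 :=
    ⟨⟨fun _ => 2, two_ne_zero⟩, fun _ => rfl⟩
  have hx : setOne A y ∈ coordSubspace A := fun j hj => by rw [setOne_val, if_pos hj]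
  have h1 : (setOne A y).val i = 1 := hle hx i hiB
  rw [setOne_val, if_neg hiA, hy] at h1
  norm_num at h1

theorem topologicalKrullDim_eq : topologicalKrullDim ChartDomain = 3 := by
  refine le_antisymm topologicalKrullDim_le ?_
  -- The members of the chain are cut out by setting the last `3 - i` coordinates to `1`.
  let c : LTSeries (TopologicalSpace.IrreducibleCloseds ChartDomain) :=
    LTSeries.mk 3 (fun i => coordSubspace {j | i.val ≤ j.val}) fun i j hij =>
      coordSubspace_lt ⟨fun k hk => (Nat.le_trans hij.le hk : i.val ≤ k.val), fun hle => by
        have h1 : i.val < 3 := (Fin.lt_def.1 hij).trans_le (Nat.le_of_lt_succ j.2)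
        have h2 := @hle ⟨i.val, h1⟩ (Set.mem_ofPred_eq ▸ Nat.le_refl i.val)
        rw [Set.mem_ofPred_eq] at h2
        exact absurd hij (not_lt.2 h2)⟩
  exact le_iSup (fun p : LTSeries (TopologicalSpace.IrreducibleCloseds ChartDomain) =>
    ((p.length : ℕ∞) : WithBot ℕ∞)) c

end ChartDomain

/-! ### Relative position in the affine Grassmannian of `SL₂` -/

/-- `x` is a power series. -/
def IsPowerSeries (x : 𝒦) : Prop := x ∈ (HahnSeries.ofPowerSeries ℤ ℂ).range

theorem IsPowerSeries.coeff_eq_zero {x : 𝒦} (hx : IsPowerSeries x) {k : ℤ} (hk : k < 0) :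
    x.coeff k = 0 := by
  obtain ⟨f, rfl⟩ := hx
  rw [HahnSeries.ofPowerSeries_apply]
  refine HahnSeries.embDomain_of_notMem_range ?_
  rintro ⟨n, hn⟩
  simp at hn
  omega

theorem isPowerSeries_single {k : ℤ} (hk : 0 ≤ k) (r : ℂ) :
    IsPowerSeries (HahnSeries.single k r) := by
  lift k to ℕ using hk
  refine ⟨PowerSeries.C r * PowerSeries.X ^ k, ?_⟩
  rw [map_mul, HahnSeries.ofPowerSeries_X_pow, HahnSeries.ofPowerSeries_C, HahnSeries.C_apply,
    HahnSeries.single_mul_single, zero_add, mul_one]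

theorem isPowerSeries_ofPowerSeries (f : 𝒪) :
    IsPowerSeries (HahnSeries.ofPowerSeries ℤ ℂ f) := ⟨f, rfl⟩

theorem isPowerSeries_zero : IsPowerSeries 0 := zero_mem _

theorem isPowerSeries_one : IsPowerSeries 1 := one_mem _

theorem IsPowerSeries.add {x y : 𝒦} (hx : IsPowerSeries x) (hy : IsPowerSeries y) :
    IsPowerSeries (x + y) :=
  add_mem hx hy

theorem IsPowerSeries.sub {x y : 𝒦} (hx : IsPowerSeries x) (hy : IsPowerSeries y) :
    IsPowerSeries (x - y) :=
  sub_mem hx hy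

theorem IsPowerSeries.neg {x : 𝒦} (hx : IsPowerSeries x) : IsPowerSeries (-x) :=
  neg_mem hx

theorem IsPowerSeries.mul {x y : 𝒦} (hx : IsPowerSeries x) (hy : IsPowerSeries y) :
    IsPowerSeries (x * y) :=
  mul_mem hx hy

theorem isPowerSeries_of_mem_GO {n : ℕ} {g : SpecialLinearGroup (Fin n) 𝒦} (hg : g ∈ GO n)
    (a b : Fin n) : IsPowerSeries (g.1 a b) := by
  obtain ⟨κ, rfl⟩ := hg
  exact ⟨κ.1 a b, rfl⟩

theorem mem_GO_of_isPowerSeries {n : ℕ} {g : SpecialLinearGroup (Fin n) 𝒦}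
    (hg : ∀ a b, IsPowerSeries (g.1 a b)) : g ∈ GO n := by
  choose κ hκ using hg
  have hmap : (HahnSeries.ofPowerSeries ℤ ℂ).mapMatrix (Matrix.of κ) = g.1 :=
    Matrix.ext fun a b => hκ a b
  refine ⟨⟨Matrix.of κ, HahnSeries.ofPowerSeries_injective (Γ := ℤ) ?_⟩, Subtype.ext hmap⟩
  rw [RingHom.map_det, hmap, map_one]
  exact g.2

/-- The upper unipotent matrix with entry `q`. -/
def upper (q : 𝒦) : SpecialLinearGroup (Fin 2) 𝒦 :=
  ⟨!![1, q; 0, 1], by simp [Matrix.det_fin_two]⟩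

/-- The lower unipotent matrix with entry `q`. -/
def lower (q : 𝒦) : SpecialLinearGroup (Fin 2) 𝒦 :=
  ⟨!![1, 0; q, 1], by simp [Matrix.det_fin_two]⟩

/-- The matrix `[[0, 1], [-1, 0]]`, which represents the nontrivial element of the Weyl group. -/
def weyl : SpecialLinearGroup (Fin 2) 𝒦 :=
  ⟨!![0, 1; -1, 0], by simp [Matrix.det_fin_two]⟩

/-- The constant matrix `diag(s, s⁻¹)`. -/
def constDiag (s : ℂ) (hs : s ≠ 0) : SpecialLinearGroup (Fin 2) 𝒦 :=
  ⟨!![HahnSeries.C s, 0; 0, HahnSeries.C s⁻¹], by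
    rw [Matrix.det_fin_two_of, ← map_mul, mul_inv_cancel₀ hs, map_one, mul_zero, sub_zero]⟩

theorem upper_mem_GO {q : 𝒦} (hq : IsPowerSeries q) : upper q ∈ GO 2 :=
  mem_GO_of_isPowerSeries <| by
    simp [Fin.forall_fin_two, upper, hq, isPowerSeries_zero, isPowerSeries_one]

theorem lower_mem_GO {q : 𝒦} (hq : IsPowerSeries q) : lower q ∈ GO 2 :=
  mem_GO_of_isPowerSeries <| by
    simp [Fin.forall_fin_two, lower, hq, isPowerSeries_zero, isPowerSeries_one]

theorem weyl_mem_GO : weyl ∈ GO 2 :=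
  mem_GO_of_isPowerSeries <| by
    simp [Fin.forall_fin_two, weyl, isPowerSeries_zero, isPowerSeries_one, isPowerSeries_one.neg]

theorem constDiag_mem_GO (s : ℂ) (hs : s ≠ 0) : constDiag s hs ∈ GO 2 :=
  mem_GO_of_isPowerSeries <| by
    simp [Fin.forall_fin_two, constDiag, isPowerSeries_zero, HahnSeries.C_apply,
      isPowerSeries_single]

theorem tpow_coroot_val : (tpow coroot).1 =
    !![HahnSeries.single 1 1, 0; 0, HahnSeries.single (-1) 1] := by
  ext a b
  fin_cases a <;> fin_cases b <;> simp [tpow, coroot]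

theorem tpow_zero {n : ℕ} : (tpow 0 : SpecialLinearGroup (Fin n) 𝒦) = 1 := by
  apply Subtype.ext
  change Matrix.diagonal (fun i : Fin n => (HahnSeries.single (0 : ℤ) (1 : ℂ) : 𝒦)) = 1
  rw [HahnSeries.single_zero_one, ← Matrix.diagonal_one]

theorem single_mul_single_neg : (HahnSeries.single 1 1 * HahnSeries.single (-1) 1 : 𝒦) = 1 := by
  rw [HahnSeries.single_mul_single]
  simp

theorem inv_val (g : SpecialLinearGroup (Fin 2) 𝒦) :
    (g⁻¹).1 = !![g.1 1 1, -g.1 0 1; -g.1 1 0, g.1 0 0] := by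
  rw [SpecialLinearGroup.SL2_inv_expl]
  rfl

/-- `RelPos` in terms of representatives: the double coset of `g⁻¹ h` is that of `t ^ a`. -/
theorem relPos_mk_iff {n : ℕ} {a : Cochar n} (ha : IsDominant a)
    {g h : SpecialLinearGroup (Fin n) 𝒦} :
    RelPos (Gr.mk g) (Gr.mk h) a ↔ ∃ k₁ ∈ GO n, ∃ k₂ ∈ GO n, g⁻¹ * h = k₁ * tpow a * k₂ := by
  constructor
  · rintro ⟨-, m, h1, h2⟩
    rw [Gr.pt, Gr.smul_mk, Gr.mk_eq_mk, tpow_zero, mul_one] at h1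
    rw [Gr.pt, Gr.smul_mk, Gr.mk_eq_mk] at h2
    exact ⟨_, h1, _, inv_mem h2, by group⟩
  · rintro ⟨k₁, hk₁, k₂, hk₂, he⟩
    refine ⟨ha, g * k₁, ?_, ?_⟩
    · rw [Gr.pt, Gr.smul_mk, Gr.mk_eq_mk, tpow_zero]
      simpa using hk₁
    · rw [Gr.pt, Gr.smul_mk, Gr.mk_eq_mk, eq_mul_of_inv_mul_eq he]
      have : (g * (k₁ * tpow a * k₂))⁻¹ * (g * k₁ * tpow a) = k₂⁻¹ := by group
      rw [this]
      exact inv_mem hk₂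

theorem isDominant_coroot : IsDominant coroot := by
  intro i j hij
  fin_cases i <;> fin_cases j <;> simp [coroot] at hij ⊢

/-- Entries of a matrix of relative position `α^∨` have at most simple poles. -/
theorem coeff_eq_zero_of_relPos {g h : SpecialLinearGroup (Fin 2) 𝒦}
    (hgh : RelPos (Gr.mk g) (Gr.mk h) coroot) (a b : Fin 2) {k : ℤ} (hk : k < -1) :
    ((g⁻¹ * h).1 a b).coeff k = 0 := by
  obtain ⟨k₁, hk₁, k₂, hk₂, he⟩ := (relPos_mk_iff isDominant_coroot).1 hgh
  have hP : ∀ m ∈ GO 2, PoleLE 0 fun _ : Fin 1 => m := fun m hm _ a b k hk =>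
    (isPowerSeries_of_mem_GO hm a b).coeff_eq_zero (by simpa using hk)
  have hT : PoleLE 1 fun _ : Fin 1 => tpow coroot := by
    intro _ a b k hk
    have h1 : k ≠ 1 := by push_cast at hk; omega
    have h2 : k ≠ -1 := by push_cast at hk; omega
    fin_cases a <;> fin_cases b <;> simp [tpow_coroot_val, h1, h2]
  rw [he]
  exact ((hP k₁ hk₁).mul hT).mul (hP k₂ hk₂) 0 a b k (by simpa using hk)

theorem tpow_coroot_notMem_GO : tpow coroot ∉ GO 2 := by
  intro h
  have := (isPowerSeries_of_mem_GO h 1 1).coeff_eq_zero (k := -1) (by norm_num)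
  simp [tpow_coroot_val] at this

theorem ne_of_relPos {L M : Gr 2} (h : RelPos L M coroot) : L ≠ M := by
  obtain ⟨-, m, h1, h2⟩ := h
  rw [h1, h2, Gr.pt, Gr.pt, tpow_zero]
  intro h3
  rw [Gr.smul_mk, Gr.smul_mk, Gr.mk_eq_mk] at h3
  exact tpow_coroot_notMem_GO (by simpa using h3)

theorem weyl_mul_tpow_mul_weyl : weyl * tpow coroot * weyl⁻¹ = (tpow coroot)⁻¹ := by
  apply Subtype.ext
  rw [inv_val]
  refine Matrix.ext fun a b => ?_
  rw [mul_val_apply, Fin.sum_univ_two, mul_val_apply, mul_val_apply, Fin.sum_univ_two,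
    Fin.sum_univ_two, inv_val, tpow_coroot_val]
  fin_cases a <;> fin_cases b <;> simp [weyl]
  exact (by ring : (-1 * HahnSeries.single 1 1 * -1 : 𝒦) = HahnSeries.single 1 1)

theorem exists_eq_mk_of_relPos_pt_zero {L : Gr 2} (h : RelPos (Gr.pt 0) L coroot) :
    ∃ k ∈ GO 2, L = Gr.mk (k * tpow coroot) := by
  obtain ⟨-, m, h1, h2⟩ := h
  refine ⟨m, ?_, h2⟩
  rw [Gr.pt, Gr.smul_mk, Gr.mk_eq_mk, tpow_zero] at h1
  simpa using h1

theorem relPos_coroot_symm {L M : Gr 2} (h : RelPos L M coroot) : RelPos M L coroot := by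
  obtain ⟨-, m, h1, h2⟩ := h
  rw [h1, h2, Gr.pt, Gr.pt, tpow_zero, Gr.smul_mk, Gr.smul_mk, relPos_mk_iff isDominant_coroot]
  refine ⟨weyl, weyl_mem_GO, weyl⁻¹, inv_mem weyl_mem_GO, ?_⟩
  rw [weyl_mul_tpow_mul_weyl]
  group

/-! ### The orbit structure of the cyclic convolution variety -/

theorem upper_val (q : 𝒦) : (upper q).1 = !![1, q; 0, 1] := rfl

theorem upper_zero : upper 0 = 1 :=
  Subtype.ext Matrix.one_fin_two.symm

theorem upper_mul_tpow_inv_mul (q : 𝒦) (g : SpecialLinearGroup (Fin 2) 𝒦) :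
    ((upper q * tpow coroot)⁻¹ * (g * tpow coroot)).1 =
      !![g.1 0 0 - q * g.1 1 0, (g.1 0 1 - q * g.1 1 1) * HahnSeries.single (-1) 1 ^ 2;
        g.1 1 0 * HahnSeries.single 1 1 ^ 2, g.1 1 1] := by
  have hT := single_mul_single_neg
  refine Matrix.ext fun a b => ?_
  rw [mul_val_apply, Fin.sum_univ_two, inv_val]
  simp only [mul_val_apply, Fin.sum_univ_two, tpow_coroot_val, upper_val]
  generalize (HahnSeries.single 1 1 : 𝒦) = T at hT ⊢
  generalize (HahnSeries.single (-1) 1 : 𝒦) = U at hT ⊢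
  fin_cases a <;> fin_cases b <;> simp
  · linear_combination (g.1 0 0 - q * g.1 1 0) * hT
  · ring
  · ring
  · linear_combination (g.1 1 1) * hT

/-- The representative `[[1, p + a t], [0, 1]] t ^ α^∨` of a point of the affine Grassmannian. -/
def latticeRep (p a : ℂ) : SpecialLinearGroup (Fin 2) 𝒦 :=
  upper (HahnSeries.single 0 p + HahnSeries.single 1 a) * tpow coroot

theorem isPowerSeries_linear (p a : ℂ) :
    IsPowerSeries (HahnSeries.single 0 p + HahnSeries.single 1 a) :=
  (isPowerSeries_single le_rfl p).add (isPowerSeries_single zero_le_one a)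

theorem latticeRep_val (p a : ℂ) : (latticeRep p a).1 =
    !![HahnSeries.single 1 1, HahnSeries.single (-1) p + HahnSeries.single 0 a;
      0, HahnSeries.single (-1) 1] := by
  refine Matrix.ext fun i j => ?_
  rw [latticeRep, mul_val_apply, Fin.sum_univ_two, tpow_coroot_val]
  fin_cases i <;> fin_cases j <;> simp [upper_val, add_mul, HahnSeries.single_mul_single]

/-- The Iwasawa-type normal form of `k t ^ α^∨` for `k ∈ SL₂(𝒪)` in the big cell. -/
theorem mk_mul_tpow_eq (κ : SpecialLinearGroup (Fin 2) 𝒪)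
    (h : PowerSeries.coeff 0 (κ.1 1 1) ≠ 0) :
    ∃ p a : ℂ, Gr.mk (SpecialLinearGroup.map (HahnSeries.ofPowerSeries ℤ ℂ) κ * tpow coroot) =
      Gr.mk (latticeRep p a) := by
  -- `p + a t` is the quotient of the entries of the second column modulo `t²`.
  set p : ℂ := PowerSeries.coeff 0 (κ.1 0 1) / PowerSeries.coeff 0 (κ.1 1 1) with hp
  set a : ℂ := (PowerSeries.coeff 1 (κ.1 0 1) - p * PowerSeries.coeff 1 (κ.1 1 1)) /
    PowerSeries.coeff 0 (κ.1 1 1) with ha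
  refine ⟨p, a, Eq.symm (Gr.mk_eq_mk.2 (mem_GO_of_isPowerSeries ?_))⟩
  have hq : (HahnSeries.single 0 p + HahnSeries.single 1 a : 𝒦) =
      HahnSeries.ofPowerSeries ℤ ℂ (PowerSeries.C p + PowerSeries.C a * PowerSeries.X) := by
    rw [map_add, map_mul, HahnSeries.ofPowerSeries_X, HahnSeries.ofPowerSeries_C,
      HahnSeries.ofPowerSeries_C, HahnSeries.C_apply, HahnSeries.C_apply,
      HahnSeries.single_mul_single, zero_add, mul_one]
  have hdvd : PowerSeries.X ^ 2 ∣
      κ.1 0 1 - (PowerSeries.C p + PowerSeries.C a * PowerSeries.X) * κ.1 1 1 := by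
    rw [PowerSeries.X_pow_dvd_iff]
    intro m hm
    interval_cases m
    · simp [add_mul, mul_assoc] at h ⊢
      rw [hp]
      simp
      field_simp
      simp
    · simp [add_mul, mul_assoc, PowerSeries.coeff_succ_X_mul] at h ⊢
      rw [ha]
      simp
      field_simp
      simp
  obtain ⟨r, hr⟩ := hdvd
  have h01 : IsPowerSeries ((HahnSeries.ofPowerSeries ℤ ℂ (κ.1 0 1) -
      HahnSeries.ofPowerSeries ℤ ℂ (PowerSeries.C p + PowerSeries.C a * PowerSeries.X) *
        HahnSeries.ofPowerSeries ℤ ℂ (κ.1 1 1)) * HahnSeries.single (-1) 1 ^ 2) := by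
    refine ⟨r, ?_⟩
    rw [← map_mul, ← map_sub, hr, map_mul, map_pow, HahnSeries.ofPowerSeries_X]
    linear_combination -(HahnSeries.ofPowerSeries ℤ ℂ r) *
      (HahnSeries.single 1 1 * HahnSeries.single (-1) 1 + 1 : 𝒦) * single_mul_single_neg
  rw [latticeRep, upper_mul_tpow_inv_mul, hq]
  simp only [Fin.forall_fin_two]
  exact ⟨⟨(isPowerSeries_ofPowerSeries _).sub
      ((isPowerSeries_ofPowerSeries _).mul (isPowerSeries_ofPowerSeries (κ.1 1 0))), h01⟩,
    (isPowerSeries_ofPowerSeries (κ.1 1 0)).mul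
      (pow_mem (isPowerSeries_single zero_le_one 1) 2),
    isPowerSeries_ofPowerSeries (κ.1 1 1)⟩

/-- Two points of the big cell in relative position `α^∨` have the same midpoint `p` on the way to
`[0]`: otherwise the upper right entry of the quotient has a pole of order two. -/
theorem eq_and_ne_of_relPos_latticeRep {p a p' a' : ℂ}
    (h : RelPos (Gr.mk (latticeRep p a)) (Gr.mk (latticeRep p' a')) coroot) : p' = p ∧ a' ≠ a := by
  have hp : p' = p := by
    have h1 := coeff_eq_zero_of_relPos h 0 1 (k := -2) (by norm_num)
    rw [latticeRep, latticeRep, upper_mul_tpow_inv_mul] at h1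
    have h2 : ((upper (HahnSeries.single 0 p' + HahnSeries.single 1 a')).1 0 1 -
        (HahnSeries.single 0 p + HahnSeries.single 1 a) *
          (upper (HahnSeries.single 0 p' + HahnSeries.single 1 a')).1 1 1) *
          HahnSeries.single (-1) 1 ^ 2 =
        (HahnSeries.single (-2) (p' - p) + HahnSeries.single (-1) (a' - a) : 𝒦) := by
      simp [upper_val, pow_two, HahnSeries.single_mul_single, sub_mul, add_mul]
      ring
    simp only [Matrix.of_apply, Matrix.cons_val_zero, Matrix.cons_val_one, Matrix.cons_val'] at h1
    rw [h2] at h1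
    simpa [sub_eq_zero] using h1
  refine ⟨hp, fun ha => ne_of_relPos h ?_⟩
  rw [hp, ha]

/-- The cyclic convolution variety of `SL₂` for the triple `(α^∨, α^∨, α^∨)`. -/
abbrev triangles : Set (GrProd 3 2) := cyclicConv ![coroot, coroot, coroot]

theorem mem_triangles_iff {L : GrProd 3 2} :
    L ∈ triangles ↔ L 2 = Gr.pt 0 ∧ RelPos (L 2) (L 0) coroot ∧ RelPos (L 0) (L 1) coroot ∧
      RelPos (L 1) (L 2) coroot := by
  refine and_congr Iff.rfl ⟨fun h => ⟨h 0, h 1, h 2⟩, fun h i => ?_⟩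
  fin_cases i
  exacts [h.1, h.2.1, h.2.2]

/-- Representatives of the triangle with coordinates `(p, a, c)`: its vertices are the two points
`[[1, p + a t], [0, 1]] t ^ α^∨`, `[[1, p + (a + c) t], [0, 1]] t ^ α^∨` and `[0]`. -/
def chartRep (x : Fin 3 → ℂ) : Fin 3 → SpecialLinearGroup (Fin 2) 𝒦 :=
  ![latticeRep (x 0) (x 1), latticeRep (x 0) (x 1 + x 2), 1]

theorem exists_eq_mk_of_mem_triangles {L : GrProd 3 2} (hL : L ∈ triangles) :
    ∃ κ : SpecialLinearGroup (Fin 2) 𝒪,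
      L 0 = Gr.mk (SpecialLinearGroup.map (HahnSeries.ofPowerSeries ℤ ℂ) κ * tpow coroot) := by
  rw [mem_triangles_iff] at hL
  obtain ⟨_, ⟨κ, rfl⟩, hκ⟩ := exists_eq_mk_of_relPos_pt_zero (hL.1 ▸ hL.2.1)
  exact ⟨κ, hκ⟩

theorem coeff_zero_det (κ : SpecialLinearGroup (Fin 2) 𝒪) :
    PowerSeries.coeff 0 (κ.1 0 0) * PowerSeries.coeff 0 (κ.1 1 1) -
      PowerSeries.coeff 0 (κ.1 0 1) * PowerSeries.coeff 0 (κ.1 1 0) = 1 := by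
  have h := congrArg (PowerSeries.coeff 0) ((Matrix.det_fin_two κ.1).symm.trans κ.2)
  simpa using h

/-- If the first vertex of a triangle is in the big cell, then so is the second, and the triangle
is in the chart. The reason is that both vertices are adjacent to the same neighbour of `[0]` in the
Bruhat-Tits tree. -/
theorem exists_eq_mk_chartRep {L : GrProd 3 2} (hL : L ∈ triangles)
    {κ : SpecialLinearGroup (Fin 2) 𝒪}
    (hκ : L 0 = Gr.mk (SpecialLinearGroup.map (HahnSeries.ofPowerSeries ℤ ℂ) κ * tpow coroot))
    (h : PowerSeries.coeff 0 (κ.1 1 1) ≠ 0) :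
    ∃ y : ChartDomain, L = GrProd.mk (chartRep y.val) := by
  rw [mem_triangles_iff] at hL
  obtain ⟨h2, -, h01, h12⟩ := hL
  obtain ⟨_, ⟨κ', rfl⟩, hκ'⟩ := exists_eq_mk_of_relPos_pt_zero (h2 ▸ relPos_coroot_symm h12)
  have hκ'' : PowerSeries.coeff 0 (κ'.1 1 1) ≠ 0 := by
    rw [hκ, hκ'] at h01
    have h3 := coeff_eq_zero_of_relPos h01 0 1 (k := -2) (by norm_num)
    -- The pole of order two of the upper right entry has coefficient `(κ⁻¹ κ')₀₁ (0)`.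
    have h4 : (SpecialLinearGroup.map (HahnSeries.ofPowerSeries ℤ ℂ) κ * tpow coroot)⁻¹ *
        (SpecialLinearGroup.map (HahnSeries.ofPowerSeries ℤ ℂ) κ' * tpow coroot) =
        (upper 0 * tpow coroot)⁻¹ *
          (SpecialLinearGroup.map (HahnSeries.ofPowerSeries ℤ ℂ) (κ⁻¹ * κ') * tpow coroot) := by
      rw [upper_zero, map_mul, map_inv]
      group
    rw [h4, upper_mul_tpow_inv_mul] at h3
    have h6 : PowerSeries.coeff 0 ((κ⁻¹ * κ').1 0 1) = 0 := by
      have h7 : (HahnSeries.ofPowerSeries ℤ ℂ ((κ⁻¹ * κ').1 0 1) *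
          HahnSeries.single (-1) 1 ^ 2).coeff (-2) = 0 := by
        generalize κ⁻¹ * κ' = μ at h3 ⊢
        simpa using h3
      rw [pow_two, HahnSeries.single_mul_single, HahnSeries.coeff_mul_single] at h7
      have h8 := HahnSeries.ofPowerSeries_apply_coeff (Γ := ℤ) ((κ⁻¹ * κ').1 0 1) 0
      rw [← h8]
      simpa using h7
    have h7 : PowerSeries.coeff 0 ((κ⁻¹ * κ').1 1 1) ≠ 0 := by
      intro h8
      have := coeff_zero_det (κ⁻¹ * κ')
      rw [h6, h8] at this
      simp at this
    have h9 : κ'.1 1 1 = κ.1 1 0 * (κ⁻¹ * κ').1 0 1 + κ.1 1 1 * (κ⁻¹ * κ').1 1 1 := by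
      have h10 : κ' = κ * (κ⁻¹ * κ') := by group
      have h11 : κ'.1 1 1 = (κ.1 * (κ⁻¹ * κ').1) 1 1 := congrArg (fun m => m.1 1 1) h10
      rw [h11, Matrix.mul_apply, Fin.sum_univ_two]
    rw [h9]
    simp only [PowerSeries.coeff_zero_eq_constantCoeff, map_add, map_mul] at h6 h7 h ⊢
    rw [h6, mul_zero, zero_add]
    exact mul_ne_zero h h7
  obtain ⟨p, a, hpa⟩ := mk_mul_tpow_eq κ h
  obtain ⟨p', a', hpa'⟩ := mk_mul_tpow_eq κ' hκ''
  rw [hpa] at hκ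
  rw [hpa'] at hκ'
  rw [hκ, hκ'] at h01
  obtain ⟨rfl, ha⟩ := eq_and_ne_of_relPos_latticeRep h01
  refine ⟨⟨![p', a, a' - a], sub_ne_zero.2 ha⟩, funext fun i => ?_⟩
  fin_cases i
  · exact hκ
  · refine hκ'.trans (congrArg (fun b => Gr.mk (latticeRep p' b)) ?_)
    exact (add_sub_cancel a a').symm
  · refine h2.trans ?_
    rw [Gr.pt, tpow_zero]
    rfl

theorem weyl_smul_mem_triangles {L : GrProd 3 2} (hL : L ∈ triangles) :
    weyl • L ∈ triangles :=
  GO_smul_mem _ ⟨weyl, weyl_mem_GO⟩ hL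

/-- The chart and its translate by the Weyl group cover the cyclic convolution variety. -/
theorem exists_eq_or_weyl_smul_eq_mk_chartRep {L : GrProd 3 2} (hL : L ∈ triangles) :
    ∃ y : ChartDomain, L = GrProd.mk (chartRep y.val) ∨ weyl • L = GrProd.mk (chartRep y.val) := by
  obtain ⟨κ, hκ⟩ := exists_eq_mk_of_mem_triangles hL
  by_cases h : PowerSeries.coeff 0 (κ.1 1 1) = 0
  · have h1 : PowerSeries.coeff 0 (κ.1 0 1) ≠ 0 := by
      intro h2
      have := coeff_zero_det κ
      rw [h, h2] at this
      simp at this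
    let w : SpecialLinearGroup (Fin 2) 𝒪 := ⟨!![0, 1; -1, 0], by simp [Matrix.det_fin_two]⟩
    have hw : SpecialLinearGroup.map (HahnSeries.ofPowerSeries ℤ ℂ) w = weyl := by
      refine Subtype.ext (Matrix.ext fun a b => ?_)
      change HahnSeries.ofPowerSeries ℤ ℂ (w.1 a b) = _
      fin_cases a <;> fin_cases b <;> simp [w, weyl]
    have hκ2 : (weyl • L) 0 =
        Gr.mk (SpecialLinearGroup.map (HahnSeries.ofPowerSeries ℤ ℂ) (w * κ) * tpow coroot) := by
      change weyl • L 0 = _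
      rw [hκ, Gr.smul_mk, map_mul, hw, mul_assoc]
    have h3 : (w * κ).1 1 1 = -κ.1 0 1 := by
      have h4 : (w * κ).1 1 1 = (w.1 * κ.1) 1 1 := rfl
      rw [h4, Matrix.mul_apply, Fin.sum_univ_two]
      simp [w]
    obtain ⟨y, hy⟩ := exists_eq_mk_chartRep (weyl_smul_mem_triangles hL) hκ2
      (by rw [h3, map_neg]; exact neg_ne_zero.2 h1)
    exact ⟨y, Or.inr hy⟩
  · obtain ⟨y, hy⟩ := exists_eq_mk_chartRep hL hκ h
    exact ⟨y, Or.inl hy⟩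

theorem lower_val (q : 𝒦) : (lower q).1 = !![1, 0; q, 1] := rfl

theorem weyl_val : weyl.1 = !![0, 1; -1, 0] := rfl

theorem unip_eq : unip = upper (HahnSeries.single 1 1) := rfl

theorem examplePoint_mem : examplePoint ∈ triangles := by
  rw [mem_triangles_iff]
  have h0 : examplePoint 0 = Gr.mk (tpow coroot) := rfl
  have h1 : examplePoint 1 = Gr.mk (unip * tpow coroot) := rfl
  have h2 : examplePoint 2 = Gr.mk 1 := by
    rw [← tpow_zero]
    rfl
  have hk : lower (HahnSeries.single 1 1) ∈ GO 2 :=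
    lower_mem_GO (isPowerSeries_single zero_le_one 1)
  refine ⟨rfl, ?_, ?_, relPos_coroot_symm ?_⟩
  · rw [h0, h2, relPos_mk_iff isDominant_coroot]
    exact ⟨1, one_mem _, 1, one_mem _, by group⟩
  · rw [h0, h1, relPos_mk_iff isDominant_coroot]
    -- `[[1, t⁻¹], [0, 1]]` is in the double coset of `t ^ α^∨`.
    refine ⟨_, mul_mem hk weyl_mem_GO, _, hk, ?_⟩
    have hT := single_mul_single_neg
    apply Subtype.ext
    have h3 : (tpow coroot)⁻¹ * (unip * tpow coroot) =
        (upper 0 * tpow coroot)⁻¹ * (unip * tpow coroot) := by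
      rw [upper_zero, one_mul]
    rw [h3, upper_mul_tpow_inv_mul]
    refine Matrix.ext fun a b => ?_
    simp only [mul_val_apply, Fin.sum_univ_two, tpow_coroot_val, unip_eq, upper_val, lower_val,
      weyl_val]
    generalize (HahnSeries.single 1 1 : 𝒦) = T at hT ⊢
    generalize (HahnSeries.single (-1) 1 : 𝒦) = U at hT ⊢
    fin_cases a <;> fin_cases b <;> simp
    · linear_combination -hT
    · linear_combination U * hT
    · linear_combination -T * hT
    · linear_combination -hT
  · rw [h1, h2, relPos_mk_iff isDominant_coroot]
    exact ⟨unip, upper_mem_GO (isPowerSeries_single zero_le_one 1), 1, one_mem _, by group⟩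

/-- The orbit map in coordinates: `[[1, p + a t], [0, 1]] diag(s, s⁻¹)` with `s² = c` carries the
example point to the triangle with coordinates `(p, a, c)`. -/
theorem exists_smul_examplePoint_eq (y : ChartDomain) :
    ∃ k ∈ GO 2, GrProd.mk (chartRep y.val) = k • examplePoint := by
  obtain ⟨s, hs⟩ := IsAlgClosed.exists_pow_nat_eq (y.val 2) two_pos
  have hs0 : s ≠ 0 := by
    rintro rfl
    exact y.2 (hs.symm.trans (by simp))
  have hd := constDiag_mem_GO s hs0
  have hu := upper_mem_GO (isPowerSeries_linear (y.val 0) (y.val 1))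
  have hcomm : constDiag s hs0 * tpow coroot = tpow coroot * constDiag s hs0 := by
    refine Subtype.ext (Matrix.ext fun a b => ?_)
    rw [mul_val_apply, mul_val_apply, Fin.sum_univ_two, Fin.sum_univ_two, tpow_coroot_val]
    fin_cases a <;> fin_cases b <;> simp [constDiag, mul_comm]
  have hupper : ∀ q r, upper q * upper r = upper (q + r) := by
    intro q r
    refine Subtype.ext (Matrix.ext fun a b => ?_)
    rw [mul_val_apply, Fin.sum_univ_two]
    fin_cases a <;> fin_cases b <;> simp [upper_val, add_comm]
  have hconj : constDiag s hs0 * unip =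
      upper (HahnSeries.single 1 (y.val 2)) * constDiag s hs0 := by
    refine Subtype.ext (Matrix.ext fun a b => ?_)
    rw [mul_val_apply, mul_val_apply, Fin.sum_univ_two, Fin.sum_univ_two, unip_eq]
    fin_cases a <;> fin_cases b <;>
      simp [constDiag, upper_val, HahnSeries.C_apply, HahnSeries.single_mul_single, ← hs, pow_two,
        hs0]
  refine ⟨_, mul_mem hu hd, funext fun i => ?_⟩
  fin_cases i
  · change Gr.mk (latticeRep _ _) = Gr.mk (_ * tpow coroot)
    rw [Gr.mk_eq_mk, mul_assoc, hcomm, ← mul_assoc]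
    simpa [latticeRep] using hd
  · change Gr.mk (latticeRep _ _) = Gr.mk (_ * (unip * tpow coroot))
    have h1 : upper (HahnSeries.single 0 (y.val 0) + HahnSeries.single 1 (y.val 1)) *
        constDiag s hs0 * (unip * tpow coroot) =
        latticeRep (y.val 0) (y.val 1 + y.val 2) * constDiag s hs0 := by
      rw [latticeRep, HahnSeries.single_add, ← add_assoc,
        ← hupper _ (HahnSeries.single 1 (y.val 2)), mul_assoc _ (tpow coroot), ← hcomm,
        mul_assoc _ (constDiag s hs0),
        ← mul_assoc (constDiag s hs0), hconj]
      simp only [mul_assoc]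
    rw [h1, Gr.mk_eq_mk]
    simpa using hd
  · change Gr.mk 1 = Gr.mk (_ * tpow 0)
    rw [Gr.mk_eq_mk, tpow_zero]
    simpa using mul_mem hu hd

theorem chartRep_mem (y : ChartDomain) : GrProd.mk (chartRep y.val) ∈ triangles := by
  obtain ⟨k, hk, h⟩ := exists_smul_examplePoint_eq y
  rw [h]
  exact GO_smul_mem _ ⟨k, hk⟩ examplePoint_mem

/-- The example point as a point of the cyclic convolution variety. -/
def exampleTriangle : triangles := ⟨examplePoint, examplePoint_mem⟩

/-- `SL₂(𝒪)` acts transitively on the cyclic convolution variety. -/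
theorem orbit_exampleTriangle : MulAction.orbit (GO 2) exampleTriangle = Set.univ := by
  refine Set.eq_univ_of_forall fun L => ?_
  obtain ⟨y, hy | hy⟩ := exists_eq_or_weyl_smul_eq_mk_chartRep L.2
  all_goals obtain ⟨k, hk, h⟩ := exists_smul_examplePoint_eq y
  · exact ⟨⟨k, hk⟩, Subtype.ext (hy.trans h).symm⟩
  · refine ⟨⟨weyl⁻¹ * k, mul_mem (inv_mem weyl_mem_GO) hk⟩, Subtype.ext ?_⟩
    change (weyl⁻¹ * k) • examplePoint = L.1
    rw [mul_smul, ← h, ← hy, inv_smul_smul]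

/-! ### The chart is an open embedding -/

/-- Every coefficient of the family of Laurent series `F` is a polynomial in the parameters. -/
def HasPolynomialCoeffs (F : ChartDomain → 𝒦) : Prop :=
  ∀ k : ℤ, ∃ P : MvPolynomial (Fin 3) ℂ, ∀ x, (F x).coeff k = MvPolynomial.eval x.val P

theorem hasPolynomialCoeffs_single (e : ℤ) (P : MvPolynomial (Fin 3) ℂ) :
    HasPolynomialCoeffs fun x => HahnSeries.single e (MvPolynomial.eval x.val P) := by
  intro k
  by_cases h : k = e
  · exact ⟨P, fun x => by simp [h]⟩
  · exact ⟨0, fun x => by simp [h]⟩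

theorem hasPolynomialCoeffs_zero : HasPolynomialCoeffs fun _ => 0 := fun _ => ⟨0, by simp⟩

theorem HasPolynomialCoeffs.add {F G : ChartDomain → 𝒦} (hF : HasPolynomialCoeffs F)
    (hG : HasPolynomialCoeffs G) : HasPolynomialCoeffs fun x => F x + G x := by
  intro k
  obtain ⟨P, hP⟩ := hF k
  obtain ⟨Q, hQ⟩ := hG k
  exact ⟨P + Q, fun x => by rw [map_add, ← hP, ← hQ]; rfl⟩

theorem hasPolynomialCoeffs_latticeRep (P Q : MvPolynomial (Fin 3) ℂ) (a b : Fin 2) :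
    HasPolynomialCoeffs fun x =>
      (latticeRep (MvPolynomial.eval x.val P) (MvPolynomial.eval x.val Q)).1 a b := by
  have h1 : ∀ e : ℤ, HasPolynomialCoeffs fun _ => HahnSeries.single e 1 := fun e => by
    simpa using hasPolynomialCoeffs_single e 1
  simp only [latticeRep_val]
  fin_cases a <;> fin_cases b
  exacts [h1 1, (hasPolynomialCoeffs_single _ P).add (hasPolynomialCoeffs_single _ Q),
    hasPolynomialCoeffs_zero, h1 (-1)]

theorem exists_coord_chartRep :
    ∃ P : Fin 3 × Fin 2 × Fin 2 × ℤ → MvPolynomial (Fin 3) ℂ, ∀ (x : ChartDomain) q,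
      coord (chartRep x.val) q = MvPolynomial.eval x.val (P q) := by
  have h : ∀ i a b, HasPolynomialCoeffs fun x => (chartRep x.val i).1 a b := by
    intro i a b
    fin_cases i
    · have h0 := hasPolynomialCoeffs_latticeRep (MvPolynomial.X 0) (MvPolynomial.X 1) a b
      simp only [MvPolynomial.eval_X] at h0
      exact h0
    · have h0 := hasPolynomialCoeffs_latticeRep (MvPolynomial.X 0)
        (MvPolynomial.X 1 + MvPolynomial.X 2) a b
      simp only [MvPolynomial.eval_X, map_add] at h0
      exact h0
    · intro k
      exact ⟨MvPolynomial.C (((1 : SpecialLinearGroup (Fin 2) 𝒦).1 a b).coeff k), fun x => by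
        rw [MvPolynomial.eval_C]; rfl⟩
  choose P hP using h
  exact ⟨fun q => P q.1 q.2.1 q.2.2.1 q.2.2.2, fun x q => hP _ _ _ _ x⟩

theorem poleLE_chartRep (x : Fin 3 → ℂ) : PoleLE 1 (chartRep x) := by
  have h : ∀ (p a : ℂ) (i j : Fin 2) (k : ℤ), k < -(1 : ℕ) →
      ((latticeRep p a).1 i j).coeff k = 0 := by
    intro p a i j k hk
    have h1 : k ≠ 1 := by push_cast at hk; omega
    have h2 : k ≠ -1 := by push_cast at hk; omega
    have h3 : k ≠ 0 := by push_cast at hk; omega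
    rw [latticeRep_val]
    fin_cases i <;> fin_cases j <;> simp [h1, h2, h3]
  intro i a b k hk
  fin_cases i
  · exact h _ _ a b k hk
  · exact h _ _ a b k hk
  · exact (isPowerSeries_of_mem_GO (one_mem (GO 2)) a b).coeff_eq_zero
      (hk.trans_le (by norm_num))

/-- The coordinates of the point `latticeRep p a` of the affine Grassmannian are recovered from any
representative `g` by these linear equations. -/
theorem coeff_of_mk_latticeRep_eq {p a : ℂ} {g : SpecialLinearGroup (Fin 2) 𝒦}
    (h : Gr.mk (latticeRep p a) = Gr.mk g) :
    (g.1 0 1).coeff (-1) = p * (g.1 1 1).coeff (-1) ∧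
      (g.1 0 1).coeff 0 = p * (g.1 1 1).coeff 0 + a * (g.1 1 1).coeff (-1) := by
  obtain ⟨k, hk, rfl⟩ : ∃ k ∈ GO 2, latticeRep p a * k = g :=
    ⟨_, Gr.mk_eq_mk.1 h, mul_inv_cancel_left _ _⟩
  have h1 := fun j : ℤ => (isPowerSeries_of_mem_GO hk 0 1).coeff_eq_zero (k := j)
  have h2 := fun j : ℤ => (isPowerSeries_of_mem_GO hk 1 1).coeff_eq_zero (k := j)
  rw [mul_val_apply, mul_val_apply, Fin.sum_univ_two, Fin.sum_univ_two, latticeRep_val]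
  constructor <;>
    simp [HahnSeries.coeff_single_mul, add_mul, h1, h2]

theorem coeff_latticeRep (p a : ℂ) : ((latticeRep p a).1 1 1).coeff (-1) = 1 := by
  rw [latticeRep_val]
  simp

/-- Clearing denominators: if `x i = u i / v` for polynomials `u i` and `v` in `y`, then any
polynomial in `x` becomes a polynomial in `y` after multiplication by a power of `v`. -/
theorem exists_eval_eq_pow_mul_eval {σ τ : Type*} (u : σ → MvPolynomial τ ℂ)
    (v : MvPolynomial τ ℂ) (f : MvPolynomial σ ℂ) :
    ∃ (d : ℕ) (F : MvPolynomial τ ℂ), ∀ (x : σ → ℂ) (y : τ → ℂ),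
      (∀ i, MvPolynomial.eval y (u i) = x i * MvPolynomial.eval y v) →
        MvPolynomial.eval y F = MvPolynomial.eval y v ^ d * MvPolynomial.eval x f := by
  induction f using MvPolynomial.induction_on with
  | C c => exact ⟨0, MvPolynomial.C c, fun x y _ => by simp⟩
  | add f g hf hg =>
    obtain ⟨d, F, hF⟩ := hf
    obtain ⟨e, G, hG⟩ := hg
    refine ⟨d + e, v ^ e * F + v ^ d * G, fun x y h => ?_⟩
    simp only [map_add, map_mul, map_pow, hF x y h, hG x y h]
    ring
  | mul_X f i hf =>
    obtain ⟨d, F, hF⟩ := hf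
    refine ⟨d + 1, F * u i, fun x y h => ?_⟩
    simp only [map_mul, hF x y h, h i, MvPolynomial.eval_X]
    ring

/-- The common denominator of the chart coordinates. -/
def chartDen : MvPolynomial (Fin 3 × Fin 2 × Fin 2 × ℤ) ℂ :=
  MvPolynomial.X (0, 1, 1, -1) ^ 2 * MvPolynomial.X (1, 1, 1, -1) ^ 2

/-- The numerators of the chart coordinates. -/
def chartNum : Fin 3 → MvPolynomial (Fin 3 × Fin 2 × Fin 2 × ℤ) ℂ :=
  ![MvPolynomial.X (0, 0, 1, -1) * MvPolynomial.X (0, 1, 1, -1) *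
      MvPolynomial.X (1, 1, 1, -1) ^ 2,
    (MvPolynomial.X (0, 0, 1, 0) * MvPolynomial.X (0, 1, 1, -1) -
      MvPolynomial.X (0, 0, 1, -1) * MvPolynomial.X (0, 1, 1, 0)) *
      MvPolynomial.X (1, 1, 1, -1) ^ 2,
    (MvPolynomial.X (1, 0, 1, 0) * MvPolynomial.X (1, 1, 1, -1) -
      MvPolynomial.X (1, 0, 1, -1) * MvPolynomial.X (1, 1, 1, 0)) *
      MvPolynomial.X (0, 1, 1, -1) ^ 2 -
    (MvPolynomial.X (0, 0, 1, 0) * MvPolynomial.X (0, 1, 1, -1) -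
      MvPolynomial.X (0, 0, 1, -1) * MvPolynomial.X (0, 1, 1, 0)) *
      MvPolynomial.X (1, 1, 1, -1) ^ 2]

theorem eval_chartNum {x : Fin 3 → ℂ} {g : Fin 3 → SpecialLinearGroup (Fin 2) 𝒦}
    (h : GrProd.mk g = GrProd.mk (chartRep x)) (i : Fin 3) :
    MvPolynomial.eval (coord g) (chartNum i) = x i * MvPolynomial.eval (coord g) chartDen := by
  obtain ⟨h1, h2⟩ := coeff_of_mk_latticeRep_eq (congrFun h 0).symm
  obtain ⟨h3, h4⟩ := coeff_of_mk_latticeRep_eq (congrFun h 1).symm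
  fin_cases i <;> simp [chartNum, chartDen, coord, h1, h2, h3, h4] <;> ring

/-- The triangle with given coordinates. -/
def chart (y : ChartDomain) : triangles := ⟨GrProd.mk (chartRep y.val), chartRep_mem y⟩

theorem continuous_chart : Continuous chart := by
  refine Continuous.subtype_mk (continuous_iff_isClosed.2 fun Z hZ => ?_) _
  obtain ⟨S, hS⟩ := isClosed_iff.1 hZ 1
  obtain ⟨P, hP⟩ := exists_coord_chartRep
  refine ChartDomain.isClosed_iff.2 ⟨MvPolynomial.bind₁ P '' S, fun x => ?_⟩
  rw [Set.mem_preimage, hS _ (poleLE_chartRep _), Set.forall_mem_image]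
  refine forall₂_congr fun p _ => ?_
  rw [eval_bind₁_of_eq (hP x)]

theorem exists_isClosed_preimage_chart {C : Set ChartDomain} (hC : IsClosed C) :
    ∃ Z : Set triangles, IsClosed Z ∧ chart ⁻¹' Z = C := by
  obtain ⟨S, hS⟩ := ChartDomain.isClosed_iff.1 hC
  choose d F hF using exists_eval_eq_pow_mul_eval chartNum chartDen
  refine ⟨_, (isClosed_setOf_forall_eval_eq_zero (F '' S)).preimage continuous_subtype_val,
    Set.ext fun x => ?_⟩
  change (∀ g, GrProd.mk g = GrProd.mk (chartRep x.val) → ∀ p ∈ F '' S, _) ↔ _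
  simp only [Set.forall_mem_image, hS]
  constructor
  · intro h f hf
    have h1 := h _ rfl hf
    rw [hF f _ _ (eval_chartNum rfl)] at h1
    have h2 : MvPolynomial.eval (coord (chartRep x.val)) chartDen = 1 := by
      simp [chartDen, coord, chartRep, coeff_latticeRep]
    simpa [h2] using h1
  · intro h g hg f hf
    rw [hF f _ _ (eval_chartNum hg), h f hf, mul_zero]

theorem isInducing_chart : Topology.IsInducing chart := by
  refine ⟨TopologicalSpace.ext_isClosed fun C => Iff.trans ?_ isClosed_induced_iff.symm⟩
  constructor
  · exact exists_isClosed_preimage_chart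
  · rintro ⟨Z, hZ, rfl⟩
    exact hZ.preimage continuous_chart

theorem chart_injective : Function.Injective chart := by
  intro x y h
  have h1 : GrProd.mk (chartRep x.val) = GrProd.mk (chartRep y.val) := congrArg Subtype.val h
  refine ChartDomain.val_injective (funext fun i => ?_)
  have h2 := (eval_chartNum rfl i).symm.trans (eval_chartNum h1 i)
  have h3 : MvPolynomial.eval (coord (chartRep x.val)) chartDen = 1 := by
    simp [chartDen, coord, chartRep, coeff_latticeRep]
  simpa [h3] using h2

/-- A triangle is in the chart as soon as some representative of its first vertex has a pole in the
lower right entry. -/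
theorem mem_range_chart {L : triangles} {g : Fin 3 → SpecialLinearGroup (Fin 2) 𝒦}
    (hg : GrProd.mk g = L.1) (h : ((g 0).1 1 1).coeff (-1) ≠ 0) : L ∈ Set.range chart := by
  obtain ⟨κ, hκ⟩ := exists_eq_mk_of_mem_triangles L.2
  suffices h1 : PowerSeries.coeff 0 (κ.1 1 1) ≠ 0 by
    obtain ⟨y, hy⟩ := exists_eq_mk_chartRep L.2 hκ h1
    exact ⟨y, Subtype.ext hy.symm⟩
  intro h2
  have h3 : Gr.mk (g 0) = L.1 0 := congrFun hg 0
  rw [hκ, Eq.comm, Gr.mk_eq_mk] at h3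
  obtain ⟨μ, hμ⟩ := h3
  have h4 : g 0 = SpecialLinearGroup.map (HahnSeries.ofPowerSeries ℤ ℂ) κ * tpow coroot *
      SpecialLinearGroup.map (HahnSeries.ofPowerSeries ℤ ℂ) μ := by
    rw [hμ, mul_inv_cancel_left]
  refine h ?_
  have h5 : (g 0).1 1 1 =
      HahnSeries.single (1 : ℤ) (1 : ℂ) * HahnSeries.ofPowerSeries ℤ ℂ (κ.1 1 0 * μ.1 0 1) +
      HahnSeries.single (-1 : ℤ) (1 : ℂ) * HahnSeries.ofPowerSeries ℤ ℂ (κ.1 1 1 * μ.1 1 1) := by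
    rw [h4, mul_val_apply, Fin.sum_univ_two, mul_val_apply, mul_val_apply, Fin.sum_univ_two,
      Fin.sum_univ_two, tpow_coroot_val]
    simp
    ring
  rw [h5, HahnSeries.coeff_add, HahnSeries.coeff_single_mul, HahnSeries.coeff_single_mul,
    (isPowerSeries_ofPowerSeries _).coeff_eq_zero (by norm_num), sub_self]
  have h6 := HahnSeries.ofPowerSeries_apply_coeff (Γ := ℤ) (κ.1 1 1 * μ.1 1 1) 0
  simp only [Nat.cast_zero] at h6
  rw [h6]
  simp only [PowerSeries.coeff_zero_eq_constantCoeff, map_mul] at h2 ⊢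
  rw [h2]
  simp

theorem isOpenEmbedding_chart : Topology.IsOpenEmbedding chart := by
  refine ⟨⟨isInducing_chart, chart_injective⟩, ?_⟩
  rw [← isClosed_compl_iff]
  have h : (Set.range chart)ᶜ = Subtype.val ⁻¹' {L : GrProd 3 2 | ∀ g, GrProd.mk g = L →
      ∀ p ∈ ({MvPolynomial.X (0, 1, 1, -1)} : Set (MvPolynomial (Fin 3 × Fin 2 × Fin 2 × ℤ) ℂ)),
        MvPolynomial.eval (coord g) p = 0} := by
    ext L
    constructor
    · rintro hL g hg p rfl
      rw [MvPolynomial.eval_X]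
      by_contra hne
      exact hL (mem_range_chart hg hne)
    · rintro hL ⟨y, rfl⟩
      have h1 := hL _ rfl _ rfl
      rw [MvPolynomial.eval_X] at h1
      exact one_ne_zero ((coeff_latticeRep _ _).symm.trans h1)
  rw [h]
  exact (isClosed_setOf_forall_eval_eq_zero _).preimage continuous_subtype_val

instance : ContinuousConstSMul (GO 2) triangles where
  continuous_const_smul g :=
    ((continuous_const_smul (g : SpecialLinearGroup (Fin 2) 𝒦)).comp
      continuous_subtype_val).subtype_mk _

/-- The translate of the chart by the nontrivial element of the Weyl group. -/
def weylChart (y : ChartDomain) : triangles := (⟨weyl, weyl_mem_GO⟩ : GO 2)⁻¹ • chart y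

theorem isOpenEmbedding_weylChart : Topology.IsOpenEmbedding weylChart :=
  (Homeomorph.smul (⟨weyl, weyl_mem_GO⟩ : GO 2)⁻¹).isOpenEmbedding.comp isOpenEmbedding_chart

theorem range_chart_union_range_weylChart :
    Set.range chart ∪ Set.range weylChart = Set.univ := by
  refine Set.eq_univ_of_forall fun L => ?_
  obtain ⟨y, hy | hy⟩ := exists_eq_or_weyl_smul_eq_mk_chartRep L.2
  · exact Or.inl ⟨y, Subtype.ext hy.symm⟩
  · refine Or.inr ⟨y, inv_smul_eq_iff.2 (Subtype.ext hy.symm)⟩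

theorem range_chart_inter_range_weylChart_nonempty :
    (Set.range chart ∩ Set.range weylChart).Nonempty := by
  -- The nontrivial Weyl group element sends `p = 1` to `p = -1`.
  let y : ChartDomain := ⟨fun _ => 1, one_ne_zero⟩
  refine ⟨chart y, ⟨y, rfl⟩, ?_⟩
  have h : (⟨weyl, weyl_mem_GO⟩ : GO 2) • chart y ∈ Set.range chart := by
    refine mem_range_chart (g := fun i => weyl * chartRep y.val i) rfl ?_
    change ((weyl * latticeRep 1 1).1 1 1).coeff (-1) ≠ 0
    rw [mul_val_apply, Fin.sum_univ_two, latticeRep_val, weyl_val]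
    have h2 : ((-1 : 𝒦) * (HahnSeries.single (-1) 1 + 1)).coeff (-1) ≠ 0 := by
      have h3 : (-1 : 𝒦) * (HahnSeries.single (-1) 1 + 1) =
          -(HahnSeries.single (-1) 1 + 1) := by ring
      rw [h3]
      simp
    simpa using h2
  obtain ⟨z, hz⟩ := h
  exact ⟨z, inv_smul_eq_iff.2 hz⟩

instance : IrreducibleSpace triangles :=
  irreducibleSpace_of_isOpenEmbedding isOpenEmbedding_chart isOpenEmbedding_weylChart
    range_chart_inter_range_weylChart_nonempty range_chart_union_range_weylChart

theorem univ_mem_irreducibleComponents_triangles :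
    Set.univ ∈ irreducibleComponents triangles := by
  rw [irreducibleComponents_eq_singleton]
  rfl

theorem topologicalKrullDim_triangles : topologicalKrullDim triangles = 3 := by
  rw [← ChartDomain.topologicalKrullDim_eq]
  refine le_antisymm (topologicalKrullDim_le_of_forall_exists_isOpenEmbedding fun L => ?_)
    isInducing_chart.topologicalKrullDim_le
  rcases range_chart_union_range_weylChart.symm ▸ Set.mem_univ L with h | h
  · exact ⟨chart, isOpenEmbedding_chart, h⟩
  · exact ⟨weylChart, isOpenEmbedding_weylChart, h⟩

/-! ### The Lie algebra of the stabilizer -/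

theorem mem_lieStab_iff {s n : ℕ} {x : GrProd s n} {X : LieAlgebra.SpecialLinear.sl (Fin n) 𝒪} :
    X ∈ lieStab x ↔ ∀ (i : Fin s) (g : SpecialLinearGroup (Fin n) 𝒦), Gr.mk g = x i → ∀ a b,
      IsPowerSeries (((g⁻¹).1 * X.1.map (HahnSeries.ofPowerSeries ℤ ℂ) * g.1) a b) :=
  isStabDual_iff x X.1 (sl_trace X)

theorem IsPowerSeries.matrix_mul {n : ℕ} {A B : Matrix (Fin n) (Fin n) 𝒦}
    (hA : ∀ a b, IsPowerSeries (A a b)) (hB : ∀ a b, IsPowerSeries (B a b)) (a b : Fin n) :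
    IsPowerSeries ((A * B) a b) := by
  rw [Matrix.mul_apply]
  exact sum_mem fun j _ => (hA a j).mul (hB j b)

/-- It suffices to test the stabilizer condition on one representative of each point. -/
theorem mem_lieStab_mk_iff {s n : ℕ} {g : Fin s → SpecialLinearGroup (Fin n) 𝒦}
    {X : LieAlgebra.SpecialLinear.sl (Fin n) 𝒪} :
    X ∈ lieStab (GrProd.mk g) ↔ ∀ (i : Fin s) (a b : Fin n),
      IsPowerSeries (((g i)⁻¹.1 * X.1.map (HahnSeries.ofPowerSeries ℤ ℂ) * (g i).1) a b) := by
  rw [mem_lieStab_iff]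
  refine ⟨fun h i => h i (g i) rfl, fun h i g' hg' a b => ?_⟩
  obtain ⟨k, hk, rfl⟩ : ∃ k ∈ GO n, g i * k = g' :=
    ⟨_, Gr.mk_eq_mk.1 hg'.symm, mul_inv_cancel_left _ _⟩
  have h1 : ((g i * k)⁻¹).1 * X.1.map (HahnSeries.ofPowerSeries ℤ ℂ) * (g i * k).1 =
      (k⁻¹).1 * ((g i)⁻¹.1 * X.1.map (HahnSeries.ofPowerSeries ℤ ℂ) * (g i).1) * k.1 := by
    have h2 : ((g i * k)⁻¹).1 = (k⁻¹).1 * ((g i)⁻¹).1 := congrArg Subtype.val (mul_inv_rev (g i) k)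
    have h3 : (g i * k).1 = (g i).1 * k.1 := rfl
    rw [h2, h3]
    simp only [Matrix.mul_assoc]
  rw [h1]
  exact IsPowerSeries.matrix_mul (IsPowerSeries.matrix_mul
    (isPowerSeries_of_mem_GO (inv_mem hk)) (h i)) (isPowerSeries_of_mem_GO hk) a b

theorem isPowerSeries_mul_single_neg_pow_iff {f : 𝒪} {n : ℕ} :
    IsPowerSeries (HahnSeries.ofPowerSeries ℤ ℂ f * HahnSeries.single (-1) 1 ^ n) ↔
      PowerSeries.X ^ n ∣ f := by
  have hT : (HahnSeries.single 1 1 ^ n * HahnSeries.single (-1) 1 ^ n : 𝒦) = 1 := by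
    rw [← mul_pow, single_mul_single_neg, one_pow]
  constructor
  · rintro ⟨r, hr⟩
    refine ⟨r, HahnSeries.ofPowerSeries_injective (Γ := ℤ) ?_⟩
    rw [map_mul, map_pow, HahnSeries.ofPowerSeries_X, hr]
    linear_combination -(HahnSeries.ofPowerSeries ℤ ℂ f) * hT
  · rintro ⟨r, rfl⟩
    refine ⟨r, ?_⟩
    rw [map_mul, map_pow, HahnSeries.ofPowerSeries_X]
    linear_combination -(HahnSeries.ofPowerSeries ℤ ℂ r) * hT

theorem apply_one_one (X : LieAlgebra.SpecialLinear.sl (Fin 2) 𝒪) : X.1 1 1 = -X.1 0 0 := by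
  have h := sl_trace X
  rw [Matrix.trace_fin_two] at h
  linear_combination h

theorem conj_upper_mul_tpow (q : 𝒦) (M : Matrix (Fin 2) (Fin 2) 𝒦) (hM : M 1 1 = -M 0 0) :
    (upper q * tpow coroot)⁻¹.1 * M * (upper q * tpow coroot).1 =
      !![M 0 0 - q * M 1 0,
        (M 0 1 + 2 * q * M 0 0 - q ^ 2 * M 1 0) * HahnSeries.single (-1) 1 ^ 2;
        M 1 0 * HahnSeries.single 1 1 ^ 2, q * M 1 0 - M 0 0] := by
  have hT := single_mul_single_neg
  refine Matrix.ext fun a b => ?_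
  rw [Matrix.mul_apply, Fin.sum_univ_two, Matrix.mul_apply, Matrix.mul_apply, Fin.sum_univ_two,
    Fin.sum_univ_two, inv_val]
  simp only [mul_val_apply, Fin.sum_univ_two, tpow_coroot_val, upper_val]
  generalize (HahnSeries.single 1 1 : 𝒦) = T at hT ⊢
  generalize (HahnSeries.single (-1) 1 : 𝒦) = U at hT ⊢
  fin_cases a <;> fin_cases b <;> simp [hM]
  · linear_combination (M 0 0 - q * M 1 0) * hT
  · ring
  · ring
  · linear_combination (q * M 1 0 - M 0 0) * hT

theorem mem_lieStab_examplePoint {X : LieAlgebra.SpecialLinear.sl (Fin 2) 𝒪} :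
    X ∈ lieStab examplePoint ↔ PowerSeries.X ^ 2 ∣ X.1 0 1 ∧ PowerSeries.X ∣ X.1 0 0 := by
  have he : examplePoint = GrProd.mk ![upper 0 * tpow coroot, unip * tpow coroot, 1] := by
    refine funext fun i => ?_
    fin_cases i
    · change Gr.mk _ = Gr.mk (upper 0 * tpow coroot)
      rw [upper_zero, one_mul]
    · rfl
    · change Gr.mk (tpow 0) = Gr.mk 1
      rw [tpow_zero]
  have hM : X.1.map (HahnSeries.ofPowerSeries ℤ ℂ) 1 1 =
      -X.1.map (HahnSeries.ofPowerSeries ℤ ℂ) 0 0 := by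
    rw [Matrix.map_apply, Matrix.map_apply, apply_one_one, map_neg]
  have hT := single_mul_single_neg
  have hint := isPowerSeries_ofPowerSeries
  have hX := isPowerSeries_single (k := 1) zero_le_one 1
  -- The upper right entry of `X`, conjugated by the second representative.
  have hb : (HahnSeries.ofPowerSeries ℤ ℂ (X.1 0 1) +
        2 * HahnSeries.single 1 1 * HahnSeries.ofPowerSeries ℤ ℂ (X.1 0 0) -
        HahnSeries.single 1 1 ^ 2 * HahnSeries.ofPowerSeries ℤ ℂ (X.1 1 0)) *
        HahnSeries.single (-1) 1 ^ 2 =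
      HahnSeries.ofPowerSeries ℤ ℂ (X.1 0 1) * HahnSeries.single (-1) 1 ^ 2 +
        HahnSeries.ofPowerSeries ℤ ℂ (2 * X.1 0 0) * HahnSeries.single (-1) 1 ^ 1 -
        HahnSeries.ofPowerSeries ℤ ℂ (X.1 1 0) := by
    rw [map_mul, map_ofNat]
    generalize (HahnSeries.single 1 1 : 𝒦) = T at hT ⊢
    generalize (HahnSeries.single (-1) 1 : 𝒦) = U at hT ⊢
    linear_combination (2 * HahnSeries.ofPowerSeries ℤ ℂ (X.1 0 0) * U -
      HahnSeries.ofPowerSeries ℤ ℂ (X.1 1 0) * (T * U + 1)) * hT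
  have hdvd : PowerSeries.X ∣ 2 * X.1 0 0 ↔ PowerSeries.X ∣ X.1 0 0 := by
    rw [PowerSeries.X_dvd_iff, PowerSeries.X_dvd_iff, map_mul, map_ofNat]
    simp
  rw [he, mem_lieStab_mk_iff]
  constructor
  · intro h
    have h1 := h 0 0 1
    have h2 := h 1 0 1
    change IsPowerSeries (((upper 0 * tpow coroot)⁻¹.1 *
      X.1.map (HahnSeries.ofPowerSeries ℤ ℂ) * (upper 0 * tpow coroot).1) 0 1) at h1
    change IsPowerSeries (((upper _ * tpow coroot)⁻¹.1 *
      X.1.map (HahnSeries.ofPowerSeries ℤ ℂ) * (upper _ * tpow coroot).1) 0 1) at h2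
    rw [conj_upper_mul_tpow _ _ hM] at h1 h2
    have h3 : IsPowerSeries (HahnSeries.ofPowerSeries ℤ ℂ (X.1 0 1) *
        HahnSeries.single (-1) 1 ^ 2) := by
      simpa using h1
    change IsPowerSeries ((HahnSeries.ofPowerSeries ℤ ℂ (X.1 0 1) +
        2 * HahnSeries.single 1 1 * HahnSeries.ofPowerSeries ℤ ℂ (X.1 0 0) -
        HahnSeries.single 1 1 ^ 2 * HahnSeries.ofPowerSeries ℤ ℂ (X.1 1 0)) *
        HahnSeries.single (-1) 1 ^ 2) at h2
    rw [hb] at h2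
    have h4 := (h2.add (hint (X.1 1 0))).sub h3
    rw [sub_add_cancel, add_sub_cancel_left, isPowerSeries_mul_single_neg_pow_iff, pow_one,
      hdvd] at h4
    exact ⟨isPowerSeries_mul_single_neg_pow_iff.1 h3, h4⟩
  · rintro ⟨h1, h2⟩ i
    rw [← isPowerSeries_mul_single_neg_pow_iff] at h1
    have key : ∀ q, IsPowerSeries q →
        IsPowerSeries ((HahnSeries.ofPowerSeries ℤ ℂ (X.1 0 1) +
          2 * q * HahnSeries.ofPowerSeries ℤ ℂ (X.1 0 0) -
          q ^ 2 * HahnSeries.ofPowerSeries ℤ ℂ (X.1 1 0)) * HahnSeries.single (-1) 1 ^ 2) →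
        ∀ a b, IsPowerSeries (((upper q * tpow coroot)⁻¹.1 *
          X.1.map (HahnSeries.ofPowerSeries ℤ ℂ) * (upper q * tpow coroot).1) a b) := by
      intro q hq h
      rw [conj_upper_mul_tpow _ _ hM]
      simp only [Fin.forall_fin_two]
      exact ⟨⟨(hint (X.1 0 0)).sub (hq.mul (hint (X.1 1 0))), h⟩,
        (hint (X.1 1 0)).mul (pow_mem hX 2), (hq.mul (hint (X.1 1 0))).sub (hint (X.1 0 0))⟩
    fin_cases i
    · refine key 0 isPowerSeries_zero ?_
      simpa using h1
    · refine key _ hX ?_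
      rw [hb]
      refine (h1.add (isPowerSeries_mul_single_neg_pow_iff.2 ?_)).sub (hint _)
      rwa [pow_one, hdvd]
    · have h1 := isPowerSeries_of_mem_GO (one_mem (GO 2))
      exact IsPowerSeries.matrix_mul (IsPowerSeries.matrix_mul
        (isPowerSeries_of_mem_GO (inv_mem (one_mem (GO 2)))) fun a b => hint (X.1 a b)) h1

/-- The three coefficients that vanish on the Lie algebra of the stabilizer. -/
def lieStabCoeffs : LieAlgebra.SpecialLinear.sl (Fin 2) 𝒪 →ₗ[ℂ] Fin 3 → ℂ where
  toFun X := ![PowerSeries.coeff 0 (X.1 0 1), PowerSeries.coeff 1 (X.1 0 1),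
    PowerSeries.coeff 0 (X.1 0 0)]
  map_add' X Y := by
    have h : ∀ a b, (X + Y).1 a b = X.1 a b + Y.1 a b := fun _ _ => rfl
    ext i
    fin_cases i <;> simp [h]
  map_smul' c X := by
    have h : ∀ a b, (c • X).1 a b = c • X.1 a b := fun _ _ => rfl
    ext i
    fin_cases i <;> simp [h]

theorem ker_lieStabCoeffs : LinearMap.ker lieStabCoeffs = lieStab examplePoint := by
  ext X
  rw [mem_lieStab_examplePoint, PowerSeries.X_pow_dvd_iff, PowerSeries.X_dvd_iff,
    ← PowerSeries.coeff_zero_eq_constantCoeff_apply, LinearMap.mem_ker]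
  constructor
  · intro h
    refine ⟨fun m hm => ?_, congrFun h 2⟩
    interval_cases m
    exacts [congrFun h 0, congrFun h 1]
  · rintro ⟨h1, h2⟩
    ext i
    fin_cases i
    exacts [h1 0 (by norm_num), h1 1 (by norm_num), h2]

theorem lieStabCoeffs_surjective : Function.Surjective lieStabCoeffs := by
  intro z
  refine ⟨⟨!![PowerSeries.C (z 2), PowerSeries.C (z 0) + PowerSeries.C (z 1) * PowerSeries.X;
    0, -PowerSeries.C (z 2)], ?_⟩, ?_⟩
  · simp [LieAlgebra.SpecialLinear.sl, Matrix.trace_fin_two]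
  · ext i
    fin_cases i <;> simp [lieStabCoeffs]

theorem finrank_quotient_lieStab : Module.finrank ℂ
    (LieAlgebra.SpecialLinear.sl (Fin 2) 𝒪 ⧸ lieStab examplePoint) = 3 := by
  rw [← ker_lieStabCoeffs,
    (lieStabCoeffs.quotKerEquivOfSurjective lieStabCoeffs_surjective).finrank_eq]
  simp

/-! ### The weights -/

theorem rhoPairing_coroot : rhoPairing (coroot + coroot + coroot) = 3 := by
  have h : ∀ i, (coroot + coroot + coroot).1 i = coroot.1 i + coroot.1 i + coroot.1 i :=
    fun _ => rfl
  simp only [rhoPairing, Fin.sum_univ_two, h]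
  simp [coroot]
  norm_num

/-- The entries of `-α^∨ - w α^∨` are even, while those of `α^∨` are odd. -/
theorem coroot_ne_weylAct (v w : Equiv.Perm (Fin 2)) :
    coroot ≠ weylAct v (-coroot - weylAct w coroot) := by
  intro h
  have hodd : ∀ i, coroot.1 i = 1 ∨ coroot.1 i = -1 := by
    intro i
    fin_cases i <;> simp [coroot]
  have h0 : coroot.1 0 = -coroot.1 (v⁻¹ 0) - coroot.1 (w⁻¹ (v⁻¹ 0)) :=
    congrArg (fun a : Cochar 2 => a.1 0) h
  have h1 := hodd 0
  have h2 := hodd (v⁻¹ 0)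
  have h3 := hodd (w⁻¹ (v⁻¹ 0))
  omega

theorem topologicalKrullDim_univ {X : Type*} [TopologicalSpace X] :
    topologicalKrullDim (Set.univ : Set X) = topologicalKrullDim X :=
  (Homeomorph.Set.univ X).isHomeomorph.topologicalKrullDim_eq

end CyclicConvolution

end

theorem mainTheorem5 :
    -- The weight `lam = mu = nu = α^∨` is dominant, and the expected dimension is `3`.
    CyclicConvolution.IsDominant CyclicConvolution.coroot ∧
    CyclicConvolution.rhoPairing
      (CyclicConvolution.coroot + CyclicConvolution.coroot + CyclicConvolution.coroot) = 3 ∧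
    -- The triple is not PRV.
    (¬ ∃ v w : Equiv.Perm (Fin 2), CyclicConvolution.coroot =
      CyclicConvolution.weylAct v
        (-CyclicConvolution.coroot - CyclicConvolution.weylAct w CyclicConvolution.coroot)) ∧
    -- The point lies in the cyclic convolution variety, and the closure of its orbit is an
    -- irreducible component of top dimension `3`.
    (∃ x : CyclicConvolution.cyclicConv
        ![CyclicConvolution.coroot, CyclicConvolution.coroot, CyclicConvolution.coroot],
      x.1 = CyclicConvolution.examplePoint ∧
      topologicalKrullDim (MulAction.orbit (CyclicConvolution.GO 2) x) = 3 ∧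
      closure (MulAction.orbit (CyclicConvolution.GO 2) x) ∈
        irreducibleComponents (CyclicConvolution.cyclicConv
          ![CyclicConvolution.coroot, CyclicConvolution.coroot, CyclicConvolution.coroot]) ∧
      topologicalKrullDim (closure (MulAction.orbit (CyclicConvolution.GO 2) x)) = 3 ∧
      ∀ B ∈ irreducibleComponents (CyclicConvolution.cyclicConv
          ![CyclicConvolution.coroot, CyclicConvolution.coroot, CyclicConvolution.coroot]),
        topologicalKrullDim B ≤ 3) ∧
    -- The Lie algebra of the stabilizer of the point is `t² e(𝒪) ⊕ t h(𝒪) ⊕ f(𝒪)`, and it has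
    -- codimension `3` in `sl₂(𝒪)`.
    (∀ X : LieAlgebra.SpecialLinear.sl (Fin 2) CyclicConvolution.𝒪,
      X ∈ CyclicConvolution.lieStab CyclicConvolution.examplePoint ↔
        PowerSeries.X ^ 2 ∣ X.1 0 1 ∧ PowerSeries.X ∣ X.1 0 0) ∧
    Module.finrank ℂ (LieAlgebra.SpecialLinear.sl (Fin 2) CyclicConvolution.𝒪 ⧸
      CyclicConvolution.lieStab CyclicConvolution.examplePoint) = 3 := by
  refine ⟨CyclicConvolution.isDominant_coroot, CyclicConvolution.rhoPairing_coroot,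
    fun ⟨v, w, h⟩ => CyclicConvolution.coroot_ne_weylAct v w h,
    ⟨CyclicConvolution.exampleTriangle, rfl, ?_, ?_, ?_, fun B _ => ?_⟩,
    fun _ => CyclicConvolution.mem_lieStab_examplePoint,
    CyclicConvolution.finrank_quotient_lieStab⟩
  · rw [CyclicConvolution.orbit_exampleTriangle, CyclicConvolution.topologicalKrullDim_univ,
      CyclicConvolution.topologicalKrullDim_triangles]
  · rw [CyclicConvolution.orbit_exampleTriangle, closure_univ]
    exact CyclicConvolution.univ_mem_irreducibleComponents_triangles
  · rw [CyclicConvolution.orbit_exampleTriangle, closure_univ,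
      CyclicConvolution.topologicalKrullDim_univ, CyclicConvolution.topologicalKrullDim_triangles]
  · exact (topologicalKrullDim_subspace_le _ B).trans
      CyclicConvolution.topologicalKrullDim_triangles.le
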